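/- **Setting.** Let $X$ be a Polish space with its Borel $\sigma$-algebra, and let $(\theta_\lambda)_{\lambda\in\mathbb{R}^d}$ be a group of transformations of $X$ ($\theta_0u=u$, $\theta_\lambda\theta_\mu u=\theta_{\lambda+\mu}u$) such that $(\lambda,u)\mapsto\theta_\lambda u$ is continuous in each variable separately. Put $T^\varepsilon_\lambda(x,u)=(x+\varepsilon\lambda,\theta_\lambda u)$ on $\mathbb{R}^d\times X$. Let $G\subset\mathbb{R}^d$ be compact with $|G|>0$ and $\lim_{\varepsilon\to0^+}|(G+\varepsilon x)\bigtriangleup G|/|G|=0$ for every $x\in\mathbb{R}^d$. Let $f_\varepsilon$ ($\varepsilon>0$) and $f$ be Borel functions $G\times X\to[0,+\infty]$; in the integral (1) below $f_\varepsilon$ is extended by $0$ to $\mathbb{R}^d\times X$. Assume that for every sequence $\varepsilon_n\to0^+$ and all $(x_n,u_n)\in G\times X$ with $$\limsup_{n\to\infty}\int_{B_R}f_{\varepsilon_n}\big(T^{\varepsilon_n}_\lambda(x_n,u_n)\big)\,d\lambda<+\infty\quad\text{for all }R>0,\tag{1}$$ the following hold: 1. (Coercivity) $(x_n,u_n)$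 has a subsequence converging in $G\times X$. 2. ($\Gamma$-liminf) If $(x_n,u_n)\to(x,u)$ in $G\times X$, then $\liminf_n f_{\varepsilon_n}(x_n,u_n)\ge f(x,u)$. Let $(\mathbf U_R)_{R>0}$ be an increasing family of bounded open subsets of $\mathbb{R}^d$ such that $\bigcap_{R>0}\overline{\mathbf U_R}=\{0\}$, $R\mapsto|\mathbf U_R|$ is left continuous, $|\mathbf U_R-\mathbf U_R|\le C|\mathbf U_R|$ for a constant $C$ and all $R>0$, and $\lim_{R\to+\infty}|(\lambda+\mathbf U_R)\bigtriangleup\mathbf U_R|/|\mathbf U_R|=0$ for every $\lambda\in\mathbb{R}^d$. For $u\in X$ let $F_\varepsilon(u)=\frac1{|G|}\int_G f_\varepsilon(x,\theta_{x/\varepsilon}u)\,dx$, and let $\phi_\varepsilon(u)$ be the probability measure on $G\times X$ that is the image of the normalized Lebesgue measure on $G$ under $x\mapsto(x,\theta_{x/\varepsilon}u)$. Spaces of probability measures carry the topology of weak convergence. Let $\varepsilon_n\to0^+$. **A.** Let $u_n\in X$ be such that $F_{\varepsilon_n}(u_n)$ is bounded, and let $P_n=\phi_{\varepsilon_n}(u_n)$.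 Then $(P_n)$ has a convergent subsequence. Moreover, whenever a subsequence $(P_{n_k})_k$ converges to a probability measure $P$ on $G\times X$: * the first marginal of $P$ is the normalized Lebesgue measure on $G$; * $P$ is $T_{\lambda(x)}$-invariant, i.e. invariant under $(x,u)\mapsto(x,\theta_{\lambda(x)}u)$ for every $C^1$ function $\lambda:\mathbb{R}^d\to\mathbb{R}^d$; * $P$-almost every $(x,u)$ is of the form $\lim_{k}\big(x_k,\theta_{x_k/\varepsilon_{n_k}}u_{n_k}\big)$ with $x_k\in G$; * $\displaystyle\liminf_{k\to\infty}F_{\varepsilon_{n_k}}(u_{n_k})\ge\int f\,dP$; * for $P$-almost every $(x,u)$ the limit $\displaystyle\lim_{R\to+\infty}\frac1{|\mathbf U_R|}\int_{\mathbf U_R}f(x,\theta_\lambda u)\,d\lambda$ exists, and $$\int f\,dP=\mathbf E^P\Big(\lim_{R\to+\infty}\frac1{|\mathbf U_R|}\int_{\mathbf U_R}f(x,\theta_\lambda u)\,d\lambda\Big).$$ **B.** Let $\mathbb P_n$ be Borel probability measures on $X$ with $\lim_{M\to+\infty}\limsup_{n\to\infty}\mathbb P_n(\{F_{\varepsilon_n}\ge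 M\})=0$. Then the sequence $(\phi_{\varepsilon_n}\#\mathbb P_n)_n$ of Borel probability measures on $\mathscr P(G\times X)$ is tight, and it converges weakly, up to a subsequence, to a probability measure on $\mathscr P(G\times X)$. -/

import Mathlib

open Set Filter Topology MeasureTheory
open scoped ENNReal NNReal Pointwise symmDiff

/-- A `d`-parameter group of transformations of `X`, continuous in each variable separately. -/
structure IsContAction {d : ℕ} {X : Type*} [TopologicalSpace X]
    (θ : EuclideanSpace ℝ (Fin d) → X → X) : Prop where
  map_zero : ∀ u, θ 0 u = u
  map_add : ∀ a b u, θ a (θ b u) = θ (a + b) u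
  continuous_param : ∀ u, Continuous fun a => θ a u
  continuous_space : ∀ a, Continuous (θ a)

/-- Compact sets of positive Lebesgue measure that are asymptotically invariant under
translations by `ε x` as `ε → 0⁺`. -/
structure IsMacroDomain {d : ℕ} (G : Set (EuclideanSpace ℝ (Fin d))) : Prop where
  isCompact : IsCompact G
  volume_pos : 0 < volume G
  shift : ∀ x : EuclideanSpace ℝ (Fin d),
    Tendsto (fun ε : ℝ => volume (((fun y => y + ε • x) '' G) ∆ G) / volume G)
      (𝓝[>] (0 : ℝ)) (𝓝 0)

/-- Increasing families `(U R)_{R > 0}` of bounded open sets which are Vitali families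
(the closures intersect exactly in the origin, `R ↦ |U R|` is left continuous,
`|U R - U R| ≤ C |U R|`) and are asymptotically invariant under translations as `R → ∞`. -/
structure IsVitaliFolner {d : ℕ} (U : ℝ → Set (EuclideanSpace ℝ (Fin d))) : Prop where
  isOpen : ∀ R, 0 < R → IsOpen (U R)
  isBounded : ∀ R, 0 < R → Bornology.IsBounded (U R)
  mono : ∀ R S, 0 < R → R ≤ S → U R ⊆ U S
  iInter_closure : ⋂ R ∈ Ioi (0 : ℝ), closure (U R) = {0}
  leftContinuous : ∀ R, 0 < R → ContinuousWithinAt (fun r => volume (U r)) (Iio R) R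
  volume_sub_le : ∃ C : ℝ≥0, ∀ R, 0 < R → volume (U R - U R) ≤ C * volume (U R)
  folner : ∀ a : EuclideanSpace ℝ (Fin d),
    Tendsto (fun R : ℝ => volume ((a +ᵥ U R) ∆ U R) / volume (U R)) atTop (𝓝 0)

/-- A function on `G × X`, extended by `0` to `ℝ^d × X`. -/
noncomputable def zeroExt {d : ℕ} {X : Type*} (G : Set (EuclideanSpace ℝ (Fin d)))
    (h : G × X → ℝ≥0∞) (p : EuclideanSpace ℝ (Fin d) × X) : ℝ≥0∞ :=
  open Classical in if hp : p.1 ∈ G then h (⟨p.1, hp⟩, p.2) else 0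

/-- The transformation `T^ε_a (x, u) = (x + ε a, θ_a u)` of `ℝ^d × X`. -/
def shiftEps {d : ℕ} {X : Type*} (θ : EuclideanSpace ℝ (Fin d) → X → X) (ε : ℝ)
    (a : EuclideanSpace ℝ (Fin d)) (p : EuclideanSpace ℝ (Fin d) × X) :
    EuclideanSpace ℝ (Fin d) × X :=
  (p.1 + ε • a, θ a p.2)

/-- Along the sequence `ε n`, the points `z n` of `G × X` have locally bounded energy:
`limsup_n ∫_{B_R} f_{ε n}(T^{ε n}_a (z n)) da < ∞` for every `R > 0`. -/
def LocallyBoundedEnergy {d : ℕ} {X : Type*} {G : Set (EuclideanSpace ℝ (Fin d))}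
    (θ : EuclideanSpace ℝ (Fin d) → X → X) (fε : ℝ → G × X → ℝ≥0∞)
    (ε : ℕ → ℝ) (z : ℕ → G × X) : Prop :=
  ∀ R : ℝ, 0 < R →
    limsup (fun n => ∫⁻ a in Metric.ball (0 : EuclideanSpace ℝ (Fin d)) R,
      zeroExt G (fε (ε n)) (shiftEps θ (ε n) a (((z n).1 : EuclideanSpace ℝ (Fin d)), (z n).2)))
      atTop < ∞

/-- Coercivity, along all sequences `ε n → 0⁺`. -/
def IsEnergyCoercive {d : ℕ} {X : Type*} [TopologicalSpace X] {G : Set (EuclideanSpace ℝ (Fin d))}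
    (θ : EuclideanSpace ℝ (Fin d) → X → X) (fε : ℝ → G × X → ℝ≥0∞) : Prop :=
  ∀ (ε : ℕ → ℝ) (z : ℕ → G × X), (∀ n, 0 < ε n) → Tendsto ε atTop (𝓝 0) →
    LocallyBoundedEnergy θ fε ε z →
    ∃ (φ : ℕ → ℕ) (w : G × X), StrictMono φ ∧ Tendsto (fun k => z (φ k)) atTop (𝓝 w)

/-- The `Γ`-liminf inequality, along all sequences `ε n → 0⁺` and all convergent sequences
with locally bounded energy. -/
def IsGammaLiminf {d : ℕ} {X : Type*} [TopologicalSpace X] {G : Set (EuclideanSpace ℝ (Fin d))}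
    (θ : EuclideanSpace ℝ (Fin d) → X → X) (fε : ℝ → G × X → ℝ≥0∞) (f : G × X → ℝ≥0∞) : Prop :=
  ∀ (ε : ℕ → ℝ) (z : ℕ → G × X) (w : G × X), (∀ n, 0 < ε n) → Tendsto ε atTop (𝓝 0) →
    LocallyBoundedEnergy θ fε ε z → Tendsto z atTop (𝓝 w) →
    f w ≤ liminf (fun n => fε (ε n) (z n)) atTop

/-- Lebesgue measure on the subtype `G`. -/
noncomputable def lebesgueOn {d : ℕ} (G : Set (EuclideanSpace ℝ (Fin d))) : Measure G :=
  (volume : Measure (EuclideanSpace ℝ (Fin d))).comap Subtype.val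

/-- `F_ε(u)`, the average over `x ∈ G` of `f_ε(x, θ_{x/ε} u)`. -/
noncomputable def macroEnergy {d : ℕ} {X : Type*} {G : Set (EuclideanSpace ℝ (Fin d))}
    (θ : EuclideanSpace ℝ (Fin d) → X → X) (fε : ℝ → G × X → ℝ≥0∞) (ε : ℝ) (u : X) : ℝ≥0∞ :=
  ⨍⁻ x, fε ε (x, θ (ε⁻¹ • (x : EuclideanSpace ℝ (Fin d))) u) ∂(lebesgueOn G)

/-- The normalized Lebesgue measure on `G`. -/
noncomputable def normLebesgue {d : ℕ} {G : Set (EuclideanSpace ℝ (Fin d))}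
    (hG : IsMacroDomain G) : ProbabilityMeasure G :=
  ⟨(volume G)⁻¹ • lebesgueOn G, ⟨by
    rw [Measure.smul_apply, lebesgueOn, comap_subtype_coe_apply hG.isCompact.measurableSet,
      image_univ, Subtype.range_coe, smul_eq_mul,
      ENNReal.inv_mul_cancel hG.volume_pos.ne' hG.isCompact.measure_lt_top.ne]⟩⟩

theorem continuous_blowup {d : ℕ} {X : Type*} [TopologicalSpace X]
    {G : Set (EuclideanSpace ℝ (Fin d))} {θ : EuclideanSpace ℝ (Fin d) → X → X}
    (hθ : IsContAction θ) (ε : ℝ) (u : X) :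
    Continuous fun x : G => (x, θ (ε⁻¹ • (x : EuclideanSpace ℝ (Fin d))) u) :=
  continuous_id.prodMk
    ((hθ.continuous_param u).comp (continuous_subtype_val.const_smul ε⁻¹))

/-- `φ_ε(u)`, the image of the normalized Lebesgue measure on `G` under
`x ↦ (x, θ_{x/ε} u)`. -/
noncomputable def blowupMeasure {d : ℕ} {X : Type*} [TopologicalSpace X] [PolishSpace X]
    [MeasurableSpace X] [BorelSpace X] {G : Set (EuclideanSpace ℝ (Fin d))}
    (hG : IsMacroDomain G) {θ : EuclideanSpace ℝ (Fin d) → X → X} (hθ : IsContAction θ)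
    (ε : ℝ) (u : X) : ProbabilityMeasure (G × X) :=
  (normLebesgue hG).map (f := fun x : G => (x, θ (ε⁻¹ • (x : EuclideanSpace ℝ (Fin d))) u))
    (continuous_blowup hθ ε u).measurable.aemeasurable

/-- `P` is invariant under `(x, u) ↦ (x, θ_{λ(x)} u)` for every `C¹` function `λ`. -/
def IsTLambdaInvariant {d : ℕ} {X : Type*} [MeasurableSpace X]
    {G : Set (EuclideanSpace ℝ (Fin d))}
    (θ : EuclideanSpace ℝ (Fin d) → X → X) (P : Measure (G × X)) : Prop :=
  ∀ lam : EuclideanSpace ℝ (Fin d) → EuclideanSpace ℝ (Fin d), ContDiff ℝ 1 lam →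
    P.map (fun p : G × X => (p.1, θ (lam p.1) p.2)) = P

/-- The space `𝒫(Z)` of probability measures on `Z`, with the topology of weak convergence and
the Borel σ-algebra of that topology. -/
def ProbSpace (Z : Type*) [MeasurableSpace Z] : Type _ := ProbabilityMeasure Z

instance ProbSpace.instTopologicalSpace (Z : Type*) [MeasurableSpace Z] [TopologicalSpace Z]
    [OpensMeasurableSpace Z] : TopologicalSpace (ProbSpace Z) :=
  inferInstanceAs (TopologicalSpace (ProbabilityMeasure Z))

instance ProbSpace.instMeasurableSpace (Z : Type*) [MeasurableSpace Z] [TopologicalSpace Z]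
    [OpensMeasurableSpace Z] : MeasurableSpace (ProbSpace Z) :=
  borel (ProbSpace Z)

instance ProbSpace.instBorelSpace (Z : Type*) [MeasurableSpace Z] [TopologicalSpace Z]
    [OpensMeasurableSpace Z] : BorelSpace (ProbSpace Z) :=
  ⟨rfl⟩

/-- `φ_ε` as a map from `X` to `𝒫(G × X)`. -/
noncomputable def blowupMap {d : ℕ} {X : Type*} [TopologicalSpace X] [PolishSpace X]
    [MeasurableSpace X] [BorelSpace X] {G : Set (EuclideanSpace ℝ (Fin d))}
    (hG : IsMacroDomain G) {θ : EuclideanSpace ℝ (Fin d) → X → X} (hθ : IsContAction θ)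
    (ε : ℝ) : X → ProbSpace (G × X) :=
  blowupMeasure hG hθ ε

theorem continuous_blowupMap {d : ℕ} {X : Type*} [TopologicalSpace X] [PolishSpace X]
    [MeasurableSpace X] [BorelSpace X] {G : Set (EuclideanSpace ℝ (Fin d))}
    (hG : IsMacroDomain G) {θ : EuclideanSpace ℝ (Fin d) → X → X} (hθ : IsContAction θ)
    (ε : ℝ) : Continuous (blowupMap hG hθ ε) := by
  refine continuous_iff_continuousAt.2 fun u => ?_
  refine (ProbabilityMeasure.tendsto_iff_forall_integral_tendsto
    (μs := blowupMeasure hG hθ ε) (μ := blowupMeasure hG hθ ε u)).2 fun g => ?_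
  have key : ∀ v : X, ∫ p, g p ∂(blowupMeasure hG hθ ε v : Measure (G × X)) =
      ∫ x : G, g (x, θ (ε⁻¹ • (x : EuclideanSpace ℝ (Fin d))) v)
        ∂(normLebesgue hG : Measure G) := fun v =>
    integral_map (continuous_blowup hθ ε v).measurable.aemeasurable
      g.continuous.aestronglyMeasurable
  simp only [key]
  refine tendsto_integral_filter_of_dominated_convergence (fun _ => ‖g‖)
    (Eventually.of_forall fun v =>
      (g.continuous.comp (continuous_blowup hθ ε v)).aestronglyMeasurable)
    (Eventually.of_forall fun v => Eventually.of_forall fun x => g.norm_coe_le_norm _)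
    (integrable_const _) (Eventually.of_forall fun x => ?_)
  exact (g.continuous.comp (continuous_const.prodMk (hθ.continuous_space _))).tendsto u

/-- The image `φ_ε # ℙ` of a probability measure `ℙ` on `X`, a probability measure on
`𝒫(G × X)`. -/
noncomputable def blowupLaw {d : ℕ} {X : Type*} [TopologicalSpace X] [PolishSpace X]
    [MeasurableSpace X] [BorelSpace X] {G : Set (EuclideanSpace ℝ (Fin d))}
    (hG : IsMacroDomain G) {θ : EuclideanSpace ℝ (Fin d) → X → X} (hθ : IsContAction θ)
    (ε : ℝ) (ℙ : ProbabilityMeasure X) : ProbabilityMeasure (ProbSpace (G × X)) :=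
  ℙ.map (continuous_blowupMap hG hθ ε).measurable.aemeasurable

/-! Everything starts from one Fubini estimate, `lintegral_localEnergy_le`: the mean under
$\phi_\varepsilon(u)$ of the energy collected by $T^\varepsilon$ over a ball $B_R$ is at most
$|B_R|F_\varepsilon(u)$. Markov's inequality at summable levels (`exists_lowEnergySet`) then yields
sets of measure at least $1-\delta$, uniformly in $n$, such that every sequence of points chosen in
them satisfies (1). Coercivity and the Γ-liminf inequality become available on these sets: the first
gives tightness and, by Prokhorov, convergent subsequences; the second gives the lower bound through
a Lipschitz regularization of truncated integrands (`lintegral_min_le_liminf_add`).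

A shift of the microscopic variable by $a$ amounts to a macroscopic translation by $\varepsilon a$,
whose effect on Lipschitz test functions vanishes because $G$ is asymptotically invariant
(`map_const_shift_eq`). Invariance under all constant shifts passes to variable ones by
simple-function approximation, since $x$ does not move (`map_shift_eq_of_forall_const`).

A limit $P$ is thus invariant under an action of $\mathbb{R}^d$, and $\int f\,dP<\infty$ by the
lower bound, so Wiener's pointwise ergodic theorem applies. A Vitali covering argument gives the
maximal inequality, hence convergence of averages is an $L^1$-closed property; it holds for
coboundaries and for invariant functions, which generate $L^2$.

For B, with high probability $u$ lies in a compact set of bounded energy. The images of such sets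
under $\phi_{\varepsilon_n}$ are relatively compact by A, and Prokhorov's theorem is used again, on
the metrizable second countable space $\mathscr P(G\times X)$. -/

section General

/-! ### Compactness and weak limits of probability measures -/

/-- Sequential criterion for the relative compactness of a union of relatively compact sets. -/
theorem isCompact_closure_iUnion_of_seq {Z : Type*} [TopologicalSpace Z]
    [TopologicalSpace.PseudoMetrizableSpace Z] {S : ℕ → Set Z}
    (hS : ∀ n, ∃ K, IsCompact K ∧ S n ⊆ K)
    (hseq : ∀ (φ : ℕ → ℕ) (z : ℕ → Z), StrictMono φ → (∀ k, z k ∈ S (φ k)) →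
      ∃ (ψ : ℕ → ℕ) (w : Z), StrictMono ψ ∧ Tendsto (z ∘ ψ) atTop (𝓝 w)) :
    IsCompact (closure (⋃ n, S n)) := by
  let := TopologicalSpace.pseudoMetrizableSpacePseudoMetric Z
  have key : ∀ y : ℕ → Z, (∀ n, y n ∈ ⋃ n, S n) →
      ∃ (ψ : ℕ → ℕ) (w : Z), StrictMono ψ ∧ Tendsto (y ∘ ψ) atTop (𝓝 w) := by
    intro y hy
    simp only [mem_iUnion] at hy
    choose m hm using hy
    -- Either one index recurs infinitely often and a single compact set suffices, or the indices
    -- tend to infinity and the sequential hypothesis applies along an extraction.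
    by_cases hk : ∃ k, ∃ᶠ n in atTop, m n = k
    · obtain ⟨k, hk⟩ := hk
      obtain ⟨ψ, hψ, hψk⟩ := extraction_of_frequently_atTop hk
      obtain ⟨K, hK, hSK⟩ := hS k
      obtain ⟨w, -, χ, hχ, hw⟩ := hK.tendsto_subseq (x := y ∘ ψ)
        fun n => hSK (hψk n ▸ hm (ψ n))
      exact ⟨ψ ∘ χ, w, hψ.comp hχ, hw⟩
    · push Not at hk
      have hm' : Tendsto m atTop atTop := by
        refine tendsto_atTop.2 fun b => ?_
        have : ∀ᶠ n in atTop, ∀ k ∈ Finset.range b, m n ≠ k :=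
          (Finset.eventually_all _).2 fun k _ => by simpa using hk k
        filter_upwards [this] with n hn
        by_contra! hlt
        exact hn (m n) (Finset.mem_range.2 hlt) rfl
      obtain ⟨ψ, hψ, hψm⟩ := strictMono_subseq_of_tendsto_atTop hm'
      obtain ⟨χ, w, hχ, hw⟩ := hseq (m ∘ ψ) (y ∘ ψ) hψm fun k => hm (ψ k)
      exact ⟨ψ ∘ χ, w, hψ.comp hχ, hw⟩
  refine IsSeqCompact.isCompact fun x hx => ?_
  have hx' : ∀ n : ℕ, ∃ y ∈ ⋃ n, S n, dist (x n) y < 1 / ((n : ℝ) + 1) := fun n =>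
    Metric.mem_closure_iff.1 (hx n) _ (by positivity)
  choose y hy hxy using hx'
  obtain ⟨ψ, w, hψ, hw⟩ := key y hy
  refine ⟨w, mem_closure_of_tendsto hw (Eventually.of_forall fun n => hy _), ψ, hψ, ?_⟩
  refine (tendsto_iff_of_dist ?_).2 hw
  refine squeeze_zero (fun _ => dist_nonneg) (fun n => (hxy (ψ n)).le) ?_
  exact tendsto_one_div_add_atTop_nhds_zero_nat.comp hψ.tendsto_atTop

/-- The space of probability measures on a second countable metrizable space is second
countable. -/
theorem secondCountableTopology_probabilityMeasure (Z : Type*) [TopologicalSpace Z]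
    [TopologicalSpace.PseudoMetrizableSpace Z] [SecondCountableTopology Z] [MeasurableSpace Z]
    [OpensMeasurableSpace Z] : SecondCountableTopology (ProbabilityMeasure Z) := by
  let := TopologicalSpace.pseudoMetrizableSpacePseudoMetric Z
  let B := TopologicalSpace.countableBasis Z
  -- Finite unions of basic open sets are countable in number, and every nonempty open set is an
  -- increasing union of them; rational lower bounds on their measures therefore control the
  -- measures of all open sets from below.
  let 𝓕 : Set (Set Z) := sUnion '' {s : Set (Set Z) | s.Finite ∧ s ⊆ B}
  have h𝓕c : 𝓕.Countable :=
    (Set.countable_ofPred_finite_subset (TopologicalSpace.countable_countableBasis Z)).image _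
  have h𝓕o : ∀ O ∈ 𝓕, IsOpen O := by
    rintro _ ⟨s, hs, rfl⟩
    exact isOpen_sUnion fun t ht => TopologicalSpace.isOpen_of_mem_countableBasis (hs.2 ht)
  let 𝓖 : Set (Set (ProbabilityMeasure Z)) :=
    (fun p : Set Z × ℚ => {P : ProbabilityMeasure Z | p.2 < (P : Measure Z).real p.1}) ''
      (𝓕 ×ˢ univ)
  have h𝓖c : 𝓖.Countable := (h𝓕c.prod countable_univ).image _
  refine ⟨𝓖, h𝓖c, le_antisymm ?_ ?_⟩
  · refine le_generateFrom ?_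
    rintro _ ⟨⟨O, q⟩, ⟨hO, -⟩, rfl⟩
    refine isOpen_iff_mem_nhds.2 fun P hP => ?_
    have := ProbabilityMeasure.toMeasure_add_pos_gt_mem_nhds P (h𝓕o O hO)
      (ε := ENNReal.ofReal ((P : Measure Z).real O - q)) (by simpa using hP)
    filter_upwards [this] with Q (hQ : _ < _ + _)
    rw [← ofReal_measureReal, ← ofReal_measureReal,
      ← ENNReal.ofReal_add measureReal_nonneg (sub_nonneg.2 hP.le)] at hQ
    have := (ENNReal.ofReal_lt_ofReal_iff_of_nonneg measureReal_nonneg).1 hQ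
    linarith
  · have hcg : ∀ P : ProbabilityMeasure Z,
        (@nhds _ (TopologicalSpace.generateFrom 𝓖) P).IsCountablyGenerated := fun P => by
      have : @SecondCountableTopology _ (TopologicalSpace.generateFrom 𝓖) :=
        @SecondCountableTopology.mk _ (TopologicalSpace.generateFrom 𝓖) ⟨𝓖, h𝓖c, rfl⟩
      let := TopologicalSpace.generateFrom 𝓖
      exact FirstCountableTopology.nhds_generated_countable P
    refine le_of_nhds_le_nhds fun P => ?_
    have := hcg P
    refine tendsto_id'.1 (tendsto_of_forall_isOpen_le_liminf' fun G hG => ?_)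
    refine le_of_forall_lt fun c hc => ?_
    obtain ⟨s, hsB, hs⟩ := (TopologicalSpace.isBasis_countableBasis Z).open_eq_sUnion hG
    have hne : s.Nonempty := by
      by_contra hs0
      simp [hs, not_nonempty_iff_eq_empty.1 hs0] at hc
    obtain ⟨e, he⟩ := ((TopologicalSpace.countable_countableBasis Z).mono hsB).exists_eq_range hne
    have hGe : G = ⋃ n, e n := by rw [hs, he, sUnion_range]
    rw [hGe, measure_iUnion_eq_iSup_accumulate] at hc
    obtain ⟨n, hn⟩ := lt_iSup_iff.1 hc
    have hacc : accumulate e n = ⋃₀ (e '' Iic n) := by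
      rw [sUnion_image]; rfl
    have hmem : accumulate e n ∈ 𝓕 := ⟨e '' Iic n, ⟨(finite_Iic n).image e, by
      rintro _ ⟨i, -, rfl⟩
      exact hsB (he ▸ mem_range_self i)⟩, hacc.symm⟩
    have hsubG : accumulate e n ⊆ G := hGe ▸ accumulate_subset_iUnion n
    obtain ⟨q, hcq, hqP⟩ : ∃ q : ℚ, c < ENNReal.ofReal q ∧
        (q : ℝ) < (P : Measure Z).real (accumulate e n) := by
      have hcr : c.toReal < (P : Measure Z).real (accumulate e n) :=
        (ENNReal.toReal_lt_toReal (ne_top_of_lt hn) (measure_ne_top _ _)).2 hn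
      obtain ⟨q, h1, h2⟩ := exists_rat_btwn hcr
      exact ⟨q, (ENNReal.lt_ofReal_iff_toReal_lt (ne_top_of_lt hn)).2 h1, h2⟩
    have hopen : @IsOpen _ (TopologicalSpace.generateFrom 𝓖)
        {Q : ProbabilityMeasure Z | (q : ℝ) < (Q : Measure Z).real (accumulate e n)} :=
      TopologicalSpace.GenerateOpen.basic _ ⟨(accumulate e n, q), ⟨hmem, mem_univ _⟩, rfl⟩
    have hev : ∀ᶠ Q : ProbabilityMeasure Z in @nhds _ (TopologicalSpace.generateFrom 𝓖) P,
        (q : ℝ) < (Q : Measure Z).real (accumulate e n) :=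
      @IsOpen.mem_nhds _ (TopologicalSpace.generateFrom 𝓖) _ _ hopen hqP
    refine hcq.trans_le (le_liminf_of_le (by isBoundedDefault) ?_)
    filter_upwards [hev] with Q hQ
    exact (ENNReal.ofReal_le_of_le_toReal hQ.le).trans (measure_mono hsubG)

/-- Almost every point of a weak limit is a limit of points of sets of full measure. -/
theorem ae_exists_tendsto_of_tendsto {Z W : Type*} [TopologicalSpace Z]
    [TopologicalSpace.PseudoMetrizableSpace Z] [SecondCountableTopology Z] [MeasurableSpace Z]
    [OpensMeasurableSpace Z] [Nonempty W] {P : ProbabilityMeasure Z}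
    {Pk : ℕ → ProbabilityMeasure Z}
    (hP : Tendsto Pk atTop (𝓝 P)) (F : ℕ → W → Z) (hF : ∀ k, ∀ᵐ z ∂(Pk k : Measure Z), z ∈ range (F k)) :
    ∀ᵐ z ∂(P : Measure Z), ∃ x : ℕ → W, Tendsto (fun k => F k (x k)) atTop (𝓝 z) := by
  let := TopologicalSpace.pseudoMetrizableSpacePseudoMetric Z
  filter_upwards [Measure.support_mem_ae (μ := (P : Measure Z))] with z hz
  have hex : ∀ r > 0, ∀ᶠ k in atTop, ∃ x, dist (F k x) z < r := by
    intro r hr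
    have hpos : 0 < (P : Measure Z) (Metric.ball z r) :=
      (Measure.mem_support_iff_forall z).1 hz _ (Metric.ball_mem_nhds z hr)
    have hlim := ProbabilityMeasure.le_liminf_measure_open_of_tendsto hP
      (Metric.isOpen_ball (x := z) (ε := r))
    filter_upwards [eventually_lt_of_lt_liminf (hpos.trans_le hlim)] with k hk
    by_contra! hno
    refine hk.ne' (measure_mono_null ?_ (hF k))
    rintro y hy ⟨x, rfl⟩
    exact absurd (Metric.mem_ball.1 hy) (not_lt.2 (hno x))
  -- Near-minimizers of the distance to `z` give one sequence that serves every radius `r` at once.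
  have hne : ∀ k : ℕ, ∃ x, dist (F k x) z < (⨅ x, dist (F k x) z) + 1 / ((k : ℝ) + 1) := fun k =>
    exists_lt_of_ciInf_lt (lt_add_of_pos_right _ (by positivity))
  choose x hx using hne
  refine ⟨x, Metric.tendsto_atTop.2 fun r hr => ?_⟩
  obtain ⟨N, hN⟩ := eventually_atTop.1 ((hex (r / 2) (half_pos hr)).and
    ((tendsto_one_div_add_atTop_nhds_zero_nat (𝕜 := ℝ)).eventually_lt_const (half_pos hr)))
  refine ⟨N, fun k hk => ?_⟩
  obtain ⟨⟨y, hy⟩, h2⟩ := hN k hk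
  have : (⨅ x, dist (F k x) z) ≤ dist (F k y) z :=
    ciInf_le ⟨0, by rintro _ ⟨x, rfl⟩; exact dist_nonneg⟩ y
  linarith [hx k]

/-! ### Lower semicontinuity of integrals along weak limits -/

section LowerBound

variable {Z : Type*} [TopologicalSpace Z] [TopologicalSpace.PseudoMetrizableSpace Z]
  [MeasurableSpace Z] [OpensMeasurableSpace Z]

/-- Lower bound for truncated integrals under weak convergence, when a `Γ`-liminf inequality
holds along sets of almost full measure. -/
theorem lintegral_min_le_liminf_add {P : ProbabilityMeasure Z} {Pk : ℕ → ProbabilityMeasure Z}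
    (hP : Tendsto Pk atTop (𝓝 P)) {h : ℕ → Z → ℝ≥0∞} (hh : ∀ k, Measurable (h k)) {f : Z → ℝ≥0∞}
    {S : ℕ → Set Z} {δ : ℝ≥0∞} (hS : ∀ k, (Pk k : Measure Z) (S k)ᶜ ≤ δ)
    (hf : ∀ (φ : ℕ → ℕ) (z : ℕ → Z) (w : Z), StrictMono φ → (∀ k, z k ∈ S (φ k)) →
      Tendsto z atTop (𝓝 w) → f w ≤ liminf (fun k => h (φ k) (z k)) atTop) (M : ℝ≥0) :
    ∫⁻ z, min (f z) M ∂(P : Measure Z) ≤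
      liminf (fun k => ∫⁻ z, h k z ∂(Pk k : Measure Z)) atTop + M * δ := by
  classical
  let := TopologicalSpace.pseudoMetrizableSpacePseudoMetric Z
  -- With the value `M` off `S n`, a point where `H n` is below `M` is forced to lie in `S n`, where
  -- the Γ-liminf hypothesis applies.
  let H : ℕ → Z → ℝ≥0∞ := fun n y => if y ∈ S n then min (h n y) M else M
  have hHM : ∀ n y, H n y ≤ M := fun n y => by
    simp only [H]; split_ifs; exacts [min_le_right _ _, le_rfl]
  -- The `m`-Lipschitz envelope of the infimum of `H n` over `n ≥ m`: continuous and bounded, hence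
  -- a test function for weak convergence, and increasing in `m`.
  let g : ℕ → Z → ℝ≥0∞ := fun m z => ⨅ (n : ℕ) (_ : m ≤ n) (y : Z), H n y + m * edist z y
  have gle : ∀ m n z y, m ≤ n → g m z ≤ H n y + m * edist z y := fun m n z y hmn =>
    (iInf₂_le n hmn).trans (iInf_le _ y)
  have gleH : ∀ m n z, m ≤ n → g m z ≤ H n z := fun m n z hmn => by
    simpa using gle m n z z hmn
  have gM : ∀ m z, g m z ≤ M := fun m z => (gleH m m z le_rfl).trans (hHM _ _)
  have gcont : ∀ m, Continuous (g m) := fun m => by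
    refine continuous_of_le_add_edist m (ENNReal.natCast_ne_top m) fun x y => ?_
    have : g m y + m * edist x y = ⨅ (n : ℕ) (_ : m ≤ n) (w : Z),
        (H n w + m * edist y w + m * edist x y) := by
      simp only [g, ENNReal.iInf_add]
    rw [this]
    refine le_iInf₂ fun n hn => le_iInf fun w => (gle m n x w hn).trans ?_
    rw [add_assoc, ← mul_add, add_comm (edist y w)]
    gcongr
    exact edist_triangle x y w
  have gmono : Monotone g := fun a b hab z => by
    refine le_iInf₂ fun n hn => le_iInf fun w => (gle a n z w (hab.trans hn)).trans ?_
    gcongr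
  -- If this fails, some `c < M` and points `y m` have energy plus `m` times the distance to `z`
  -- below `c`. They are within `c / m` of `z`, so they converge to it with energies below `c`,
  -- against the Γ-liminf inequality.
  have gsup : ∀ z, min (f z) M ≤ ⨆ m, g m z := by
    intro z
    by_contra! hlt
    obtain ⟨c, hc1, hc2⟩ := exists_between hlt
    have hcM : c < M := hc2.trans_le (min_le_right _ _)
    have hex : ∀ m, ∃ n y, m ≤ n ∧ H n y + m * edist z y < c := fun m => by
      have : g m z < c := (le_iSup (fun m => g m z) m).trans_lt hc1
      simp only [g, iInf_lt_iff] at this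
      obtain ⟨n, hn, y, hy⟩ := this
      exact ⟨n, y, hn, hy⟩
    choose n y hmn hy using hex
    obtain ⟨ψ, hψ, hnψ⟩ := strictMono_subseq_of_tendsto_atTop
      (tendsto_atTop_mono hmn tendsto_id)
    have hHc : ∀ m, H (n m) (y m) < c := fun m => le_self_add.trans_lt (hy m)
    have hyS : ∀ m, y m ∈ S (n m) := fun m => by
      by_contra hno
      have := hHc m
      simp only [H, if_neg hno] at this
      exact absurd this hcM.le.not_gt
    have hhc : ∀ m, h (n m) (y m) < c := fun m => by
      have := hHc m
      simp only [H, if_pos (hyS m)] at this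
      exact (min_lt_iff.1 this).resolve_right hcM.le.not_gt
    have hylim : Tendsto y atTop (𝓝 z) := by
      rw [EMetric.tendsto_atTop]
      intro r hr
      have hcr : Tendsto (fun m : ℕ => c / (m : ℝ≥0∞)) atTop (𝓝 0) :=
        ENNReal.Tendsto.const_div ENNReal.tendsto_nat_nhds_top (Or.inr (ne_top_of_lt hcM)) |>.trans (by simp)
      obtain ⟨N, hN⟩ := eventually_atTop.1 ((hcr.eventually_lt_const hr).and (eventually_gt_atTop 0))
      refine ⟨N, fun m hm => ?_⟩
      refine lt_of_le_of_lt ?_ (hN m hm).1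
      rw [edist_comm, ENNReal.le_div_iff_mul_le (Or.inl (by simpa using (hN m hm).2.ne'))
        (Or.inl (ENNReal.natCast_ne_top m)), mul_comm]
      exact le_add_self.trans (hy m).le
    have := hf (n ∘ ψ) (y ∘ ψ) z hnψ (fun k => hyS _) (hylim.comp hψ.tendsto_atTop)
    have h2 : liminf (fun k => h ((n ∘ ψ) k) ((y ∘ ψ) k)) atTop ≤ c :=
      liminf_le_of_le (by isBoundedDefault) fun b hb => by
        obtain ⟨k, hk⟩ := hb.exists
        exact hk.trans (hhc _).le
    exact absurd (hc2.trans_le ((min_le_left _ _).trans (this.trans h2))) (lt_irrefl _)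
  have hgm : ∀ m, ∫⁻ z, g m z ∂(P : Measure Z) ≤
      liminf (fun k => ∫⁻ z, h k z ∂(Pk k : Measure Z)) atTop + M * δ := by
    intro m
    let gb : BoundedContinuousFunction Z ℝ≥0 := BoundedContinuousFunction.mkOfBound
      ⟨fun z => (g m z).toNNReal, ENNReal.continuousOn_toNNReal.comp_continuous (gcont m)
        fun z => ne_top_of_le_ne_top ENNReal.coe_ne_top (gM m z)⟩ M fun x y => by
        have hb : ∀ z, ((g m z).toNNReal : ℝ) ≤ M := fun z => by
          exact_mod_cast ENNReal.toNNReal_mono ENNReal.coe_ne_top (gM m z)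
        rw [NNReal.dist_eq, abs_le]
        change -(M : ℝ) ≤ (g m x).toNNReal - (g m y).toNNReal ∧
          ((g m x).toNNReal - (g m y).toNNReal : ℝ) ≤ M
        constructor <;> linarith [hb x, hb y, (g m x).toNNReal.2, (g m y).toNNReal.2]
    have hgb : ∀ z, (gb z : ℝ≥0∞) = g m z := fun z =>
      ENNReal.coe_toNNReal (ne_top_of_le_ne_top ENNReal.coe_ne_top (gM m z))
    have hlim := (ProbabilityMeasure.tendsto_iff_forall_lintegral_tendsto.1 hP) gb
    simp only [hgb] at hlim
    rw [← hlim.liminf_eq]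
    calc liminf (fun k => ∫⁻ z, g m z ∂(Pk k : Measure Z)) atTop
        ≤ liminf (fun k => ∫⁻ z, h k z ∂(Pk k : Measure Z) + M * δ) atTop := by
          refine liminf_le_liminf ?_
          filter_upwards [eventually_ge_atTop m] with k hk
          calc ∫⁻ z, g m z ∂(Pk k : Measure Z)
              ≤ ∫⁻ z, h k z + (S k)ᶜ.indicator (fun _ => (M : ℝ≥0∞)) z ∂(Pk k : Measure Z) := by
                refine lintegral_mono fun z => (gleH m k z hk).trans ?_
                by_cases hz : z ∈ S k <;> simp [H, hz]
            _ = ∫⁻ z, h k z ∂(Pk k : Measure Z) +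
                ∫⁻ z, (S k)ᶜ.indicator (fun _ => (M : ℝ≥0∞)) z ∂(Pk k : Measure Z) :=
                lintegral_add_left (hh k) _
            _ ≤ _ := by
                gcongr
                exact (lintegral_indicator_const_le _ _).trans (by gcongr; exact hS k)
      _ = _ := by
          exact liminf_add_const _ _ _ (by isBoundedDefault) (by isBoundedDefault)
  calc ∫⁻ z, min (f z) M ∂(P : Measure Z) ≤ ∫⁻ z, ⨆ m, g m z ∂(P : Measure Z) :=
        lintegral_mono gsup
    _ = ⨆ m, ∫⁻ z, g m z ∂(P : Measure Z) :=
        lintegral_iSup (fun m => (gcont m).measurable) gmono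
    _ ≤ _ := iSup_le hgm

/-- Lower bound for integrals under weak convergence, when a `Γ`-liminf inequality holds along
sets of almost full measure. -/
theorem lintegral_le_liminf_of_gammaLiminf {P : ProbabilityMeasure Z}
    {Pk : ℕ → ProbabilityMeasure Z}
    (hP : Tendsto Pk atTop (𝓝 P)) {h : ℕ → Z → ℝ≥0∞} (hh : ∀ k, Measurable (h k)) {f : Z → ℝ≥0∞}
    (hfm : Measurable f)
    (hf : ∀ δ : ℝ≥0, 0 < δ → ∃ S : ℕ → Set Z, (∀ k, (Pk k : Measure Z) (S k)ᶜ ≤ δ) ∧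
      ∀ (φ : ℕ → ℕ) (z : ℕ → Z) (w : Z), StrictMono φ → (∀ k, z k ∈ S (φ k)) →
      Tendsto z atTop (𝓝 w) → f w ≤ liminf (fun k => h (φ k) (z k)) atTop) :
    ∫⁻ z, f z ∂(P : Measure Z) ≤ liminf (fun k => ∫⁻ z, h k z ∂(Pk k : Measure Z)) atTop := by
  have hM : ∀ M : ℝ≥0, ∫⁻ z, min (f z) M ∂(P : Measure Z) ≤
      liminf (fun k => ∫⁻ z, h k z ∂(Pk k : Measure Z)) atTop := by
    intro M
    refine ENNReal.le_of_forall_pos_le_add fun η hη _ => ?_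
    -- The exceptional sets cost `M * δ ≤ η`; the `+ 1` covers `M = 0`.
    obtain ⟨S, hS, hS'⟩ := hf (η / (M + 1)) (by positivity)
    refine (lintegral_min_le_liminf_add hP hh hS hS' M).trans ?_
    gcongr
    norm_cast
    rw [mul_div_assoc']
    exact div_le_of_le_mul₀ (by positivity) (by positivity) (by nlinarith [M.2, η.2])
  have hsup : ∀ z, f z = ⨆ n : ℕ, min (f z) ((n : ℝ≥0) : ℝ≥0∞) := fun z => by
    refine le_antisymm ?_ (iSup_le fun n => min_le_left _ _)
    refine le_of_forall_lt fun c hc => ?_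
    obtain ⟨n, hn⟩ := ENNReal.exists_nat_gt (ne_top_of_lt hc)
    exact lt_iSup_iff.2 ⟨n, lt_min hc (by simpa using hn)⟩
  calc ∫⁻ z, f z ∂(P : Measure Z) = ∫⁻ z, ⨆ n : ℕ, min (f z) ((n : ℝ≥0) : ℝ≥0∞) ∂(P : Measure Z) :=
        lintegral_congr hsup
    _ = ⨆ n : ℕ, ∫⁻ z, min (f z) ((n : ℝ≥0) : ℝ≥0∞) ∂(P : Measure Z) :=
        lintegral_iSup (fun n => hfm.min measurable_const)
          fun a b hab z => min_le_min le_rfl (by simpa using hab)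
    _ ≤ _ := iSup_le fun n => hM n

end LowerBound

end General

/-! ### Vitali coverings by translates of the averaging sets -/

namespace IsVitaliFolner

variable {d : ℕ} {U : ℝ → Set (EuclideanSpace ℝ (Fin d))}

theorem nonempty (hU : IsVitaliFolner U) {R : ℝ} (hR : 0 < R) : (U R).Nonempty := by
  rw [← closure_nonempty_iff]
  refine ⟨0, ?_⟩
  have : (0 : EuclideanSpace ℝ (Fin d)) ∈ ⋂ R ∈ Ioi (0 : ℝ), closure (U R) := by
    rw [hU.iInter_closure]; rfl
  exact mem_iInter₂.1 this R hR

theorem volume_pos (hU : IsVitaliFolner U) {R : ℝ} (hR : 0 < R) : 0 < volume (U R) :=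
  (hU.isOpen R hR).measure_pos _ (hU.nonempty hR)

theorem volume_ne_top (hU : IsVitaliFolner U) {R : ℝ} (hR : 0 < R) : volume (U R) ≠ ∞ :=
  (hU.isBounded R hR).measure_lt_top.ne

/-- Vitali covering estimate for the translates of the sets `U R`, with `R` in a finite set of
radii. -/
theorem mul_volume_le_lintegral (hU : IsVitaliFolner U) {C : ℝ≥0}
    (hC : ∀ R, 0 < R → volume (U R - U R) ≤ C * volume (U R)) {F : Finset ℝ}
    (hF : ∀ R ∈ F, 0 < R) (h : EuclideanSpace ℝ (Fin d) → ℝ≥0∞) (t : ℝ≥0∞)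
    {A W : Set (EuclideanSpace ℝ (Fin d))}
    (hA : ∀ b ∈ A, ∃ R ∈ F, t * volume (U R) ≤ ∫⁻ a in U R, h (b + a) ∧ b +ᵥ U R ⊆ W) :
    t * volume A ≤ C * ∫⁻ a in W, h a := by
  classical
  let T : Set (EuclideanSpace ℝ (Fin d) × ℝ) :=
    {p | p.2 ∈ F ∧ t * volume (U p.2) ≤ ∫⁻ a in U p.2, h (p.1 + a) ∧ p.1 +ᵥ U p.2 ⊆ W}
  -- The covering lemma compares sizes only up to a factor 2. Taking 3 to the power of the rank of
  -- the radius in `F` makes `δ p ≤ 2 * δ q` equivalent to an honest comparison of radii. Then `U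
  -- p.2 ⊆ U q.2`, so when the translates meet, the centre of `p` lies in `q.1 + (U q.2 - U q.2)`:
  -- no dilation is involved.
  let δ : EuclideanSpace ℝ (Fin d) × ℝ → ℝ := fun p => 3 ^ (F.filter (· < p.2)).card
  have hTpos : ∀ p ∈ T, 0 < p.2 := fun p hp => hF _ hp.1
  obtain ⟨u, huT, hdisj, hcov⟩ := Vitali.exists_disjoint_subfamily_covering_enlargement
    (fun p : EuclideanSpace ℝ (Fin d) × ℝ => p.1 +ᵥ U p.2) T δ 2 (by norm_num)
    (fun p _ => by positivity) (3 ^ F.card)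
    (fun p _ => pow_le_pow_right₀ (by norm_num) (Finset.card_filter_le _ _))
    (fun p hp => (hU.nonempty (hTpos p hp)).vadd_set)
  have hopen : ∀ p ∈ u, IsOpen (p.1 +ᵥ U p.2) := fun p hp =>
    (hU.isOpen _ (hTpos p (huT hp))).vadd p.1
  have huc : u.Countable := hdisj.countable_of_isOpen hopen
    fun p hp => (hU.nonempty (hTpos p (huT hp))).vadd_set
  have hδ : ∀ p ∈ T, ∀ q ∈ T, δ p ≤ 2 * δ q → p.2 ≤ q.2 := by
    intro p hp q hq hpq
    by_contra! hlt
    have hcard : (F.filter (· < q.2)).card + 1 ≤ (F.filter (· < p.2)).card := by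
      rw [Nat.succ_le_iff]
      refine Finset.card_lt_card (Finset.ssubset_iff_of_subset ?_ |>.2 ⟨q.2, ?_, ?_⟩)
      · intro r hr
        simp only [Finset.mem_filter] at hr ⊢
        exact ⟨hr.1, hr.2.trans hlt⟩
      · simpa using ⟨hq.1, hlt⟩
      · simp
    have h3 : (3 : ℝ) ^ ((F.filter (· < q.2)).card + 1) ≤ δ p :=
      pow_le_pow_right₀ (by norm_num) hcard
    have hpos : 0 < δ q := by positivity
    have : (3 : ℝ) ^ ((F.filter (· < q.2)).card + 1) = 3 * δ q := by
      rw [pow_succ, mul_comm]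
    linarith
  have hAcov : A ⊆ ⋃ p ∈ u, p.1 +ᵥ (U p.2 - U p.2) := by
    intro b hb
    obtain ⟨R, hRF, hR⟩ := hA b hb
    have hbT : (b, R) ∈ T := ⟨hRF, hR⟩
    obtain ⟨q, hqu, ⟨x, hx1, hx2⟩, hbq⟩ := hcov (b, R) hbT
    have hRq := hδ _ hbT _ (huT hqu) hbq
    obtain ⟨y, hy, rfl⟩ := hx1
    obtain ⟨z, hz, hzy⟩ := hx2
    refine mem_iUnion₂.2 ⟨q, hqu, z - y, sub_mem_sub hz (hU.mono _ _ (hF R hRF) hRq hy), ?_⟩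
    simp only [vadd_eq_add] at hzy ⊢
    rw [← add_sub_assoc, hzy, add_sub_cancel_right]
  have htrans : ∀ p : EuclideanSpace ℝ (Fin d) × ℝ,
      ∫⁻ a in U p.2, h (p.1 + a) = ∫⁻ a in p.1 +ᵥ U p.2, h a := by
    intro p
    have := (measurePreserving_add_left (volume : Measure (EuclideanSpace ℝ (Fin d))) p.1)
      |>.setLIntegral_comp_emb (MeasurableEquiv.addLeft p.1).measurableEmbedding h (U p.2)
    exact this.trans (by rfl)
  calc t * volume A ≤ t * ∑' p : u, volume (p.1.1 +ᵥ (U p.1.2 - U p.1.2)) := by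
        gcongr
        exact (measure_mono hAcov).trans (measure_biUnion_le _ huc _)
    _ ≤ t * ∑' p : u, C * volume (U p.1.2) := by
        gcongr with p
        rw [measure_vadd]
        exact hC _ (hTpos _ (huT p.2))
    _ = C * ∑' p : u, t * volume (U p.1.2) := by
        rw [ENNReal.tsum_mul_left, ENNReal.tsum_mul_left, ← mul_assoc, ← mul_assoc, mul_comm t]
    _ ≤ C * ∑' p : u, ∫⁻ a in p.1.1 +ᵥ U p.1.2, h a := by
        gcongr with p
        rw [← htrans]
        exact (huT p.2).2.1
    _ = C * ∫⁻ a in ⋃ p ∈ u, p.1 +ᵥ U p.2, h a := by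
        rw [lintegral_biUnion huc (fun p hp => (hopen p hp).measurableSet) hdisj]
    _ ≤ C * ∫⁻ a in W, h a := by
        gcongr
        exact iUnion₂_subset fun p hp => (huT hp).2.2

/-- By left continuity, an averaged lower bound for a real radius holds for a rational one. -/
theorem exists_rat_lt_setLIntegral (hU : IsVitaliFolner U) {h : EuclideanSpace ℝ (Fin d) → ℝ≥0∞}
    {t : ℝ≥0∞} {R : ℝ} (hR : 0 < R) (hlt : t * volume (U R) < ∫⁻ a in U R, h a) :
    ∃ q : ℚ, 0 < (q : ℝ) ∧ t * volume (U q) < ∫⁻ a in U q, h a := by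
  obtain ⟨r, hr, hr', hrlim⟩ : ∃ r : ℕ → ℚ, Monotone r ∧ (∀ n, (r n : ℝ) ∈ Ioo 0 R) ∧
      Tendsto (fun n => (r n : ℝ)) atTop (𝓝 R) := by
    obtain ⟨r, hr, hrR, hlim⟩ := Real.exists_seq_rat_strictMono_tendsto R
    obtain ⟨N, hN⟩ := eventually_atTop.1 (hlim.eventually_const_lt hR)
    exact ⟨fun n => r (n + N), fun a b hab => hr.monotone (by lia),
      fun n => ⟨hN _ (by lia), hrR _⟩, hlim.comp (tendsto_add_atTop_nat N)⟩
  have hmono : Monotone fun n => U (r n) := fun a b hab =>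
    hU.mono _ _ (hr' a).1 (by exact_mod_cast hr hab)
  have hsub : (⋃ n, U (r n)) ⊆ U R := iUnion_subset fun n => hU.mono _ _ (hr' n).1 (hr' n).2.le
  -- Left continuity makes the sets of smaller rational radius exhaust `U R` up to a null set, so
  -- the integral over `U R` is the supremum of theirs.
  have hvol : volume (⋃ n, U (r n)) = volume (U R) := by
    refine tendsto_nhds_unique (tendsto_measure_iUnion_atTop hmono) ?_
    exact (hU.leftContinuous R hR).tendsto.comp
      (tendsto_nhdsWithin_iff.2 ⟨hrlim, Eventually.of_forall fun n => (hr' n).2⟩)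
  have hae : (⋃ n, U (r n)) =ᵐ[volume] U R :=
    ae_eq_of_subset_of_measure_ge hsub hvol.ge
      (MeasurableSet.iUnion fun n => (hU.isOpen _ (hr' n).1).measurableSet).nullMeasurableSet
      (hU.volume_ne_top hR)
  rw [← setLIntegral_congr hae] at hlt
  rw [setLIntegral_iUnion_of_directed _ (hmono.directed_le)] at hlt
  obtain ⟨n, hn⟩ := lt_iSup_iff.1 hlt
  refine ⟨r n, (hr' n).1, lt_of_le_of_lt ?_ hn⟩
  gcongr
  exact hU.mono _ _ (hr' n).1 (hr' n).2.le

end IsVitaliFolner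

/-! ### The maximal inequality for measure-preserving actions -/

/-- A measurable action of `ℝ^d` by transformations preserving a probability measure. -/
structure IsPreservingAction {d : ℕ} {Ω : Type*} [MeasurableSpace Ω]
    (S : EuclideanSpace ℝ (Fin d) → Ω → Ω) (P : Measure Ω) : Prop where
  measurable : Measurable (Function.uncurry S)
  map_zero : ∀ p, S 0 p = p
  map_add : ∀ a b p, S a (S b p) = S (a + b) p
  preserving : ∀ a, MeasurePreserving (S a) P P

namespace IsPreservingAction

variable {d : ℕ} {Ω : Type*} [MeasurableSpace Ω] {S : EuclideanSpace ℝ (Fin d) → Ω → Ω}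
  {P : Measure Ω} {U : ℝ → Set (EuclideanSpace ℝ (Fin d))}

theorem measurable_setLIntegral (hS : IsPreservingAction S P) {h : Ω → ℝ≥0∞} (hh : Measurable h)
    (ν : Measure (EuclideanSpace ℝ (Fin d))) [SFinite ν] :
    Measurable fun p => ∫⁻ a, h (S a p) ∂ν :=
  Measurable.lintegral_prod_left (f := fun a p => h (S a p)) (hh.comp hS.measurable)

variable [IsProbabilityMeasure P]

theorem lintegral_lintegral_comp (hS : IsPreservingAction S P)
    (ν : Measure (EuclideanSpace ℝ (Fin d))) [SFinite ν] {h : Ω → ℝ≥0∞} (hh : Measurable h) :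
    ∫⁻ p, ∫⁻ a, h (S a p) ∂ν ∂P = ν univ * ∫⁻ p, h p ∂P := by
  rw [lintegral_lintegral_swap]
  · simp_rw [fun a => (hS.preserving a).lintegral_comp hh]
    rw [lintegral_const, mul_comm]
  · exact ((hh.comp hS.measurable).comp measurable_swap).aemeasurable

/-- Transference: fix `p` and apply the covering estimate on $\mathbb{R}^d$ to `a ↦ h (S a p)`, with
centres in a ball of radius `r` containing every `U R`, `R ∈ F`, so that only the ball of radius `2
* r` is seen. Integrating in `p`, invariance leaves the volumes of the two balls, whose ratio is the
factor `2 ^ d`. -/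
theorem maximal_finset (hS : IsPreservingAction S P) (hU : IsVitaliFolner U) {C : ℝ≥0}
    (hC : ∀ R, 0 < R → volume (U R - U R) ≤ C * volume (U R)) {h : Ω → ℝ≥0∞}
    (hh : Measurable h) (t : ℝ≥0∞) {F : Finset ℝ} (hF : ∀ R ∈ F, 0 < R) :
    t * P {p | ∃ R ∈ F, t * volume (U R) < ∫⁻ a in U R, h (S a p)} ≤
      C * 2 ^ d * ∫⁻ p, h p ∂P := by
  set A : Set Ω := {p | ∃ R ∈ F, t * volume (U R) < ∫⁻ a in U R, h (S a p)} with hA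
  have hAm : MeasurableSet A := by
    have : A = ⋃ R ∈ F, {p | t * volume (U R) < ∫⁻ a in U R, h (S a p)} := by
      ext p; simp [hA]
    rw [this]
    exact Finset.measurableSet_biUnion _ fun R _ =>
      measurableSet_lt measurable_const (hS.measurable_setLIntegral hh _)
  obtain ⟨r, hr0, hr⟩ : ∃ r : ℝ, 0 < r ∧ ∀ R ∈ F, U R ⊆ Metric.ball 0 r := by
    have hb : Bornology.IsBounded (⋃ R ∈ F, U R) :=
      (Bornology.isBounded_biUnion_finset F).2 fun R hR => hU.isBounded R (hF R hR)
    obtain ⟨r, hr⟩ := hb.subset_ball 0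
    exact ⟨max r 1, by positivity, fun R hR =>
      (subset_iUnion₂ (s := fun R (_ : R ∈ F) => U R) R hR).trans
        (hr.trans (Metric.ball_subset_ball (le_max_left _ _)))⟩
  have hcover : ∀ p, t * ∫⁻ b in Metric.ball 0 r, A.indicator 1 (S b p) ≤
      C * ∫⁻ a in Metric.ball 0 (2 * r), h (S a p) := by
    intro p
    have := hU.mul_volume_le_lintegral hC hF (fun a => h (S a p)) t
      (A := {b ∈ Metric.ball 0 r | S b p ∈ A}) (W := Metric.ball 0 (2 * r)) ?_
    · refine le_trans (le_of_eq ?_) this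
      congr 1
      have hm : MeasurableSet {b | S b p ∈ A} :=
        (hS.measurable.comp measurable_prodMk_right) hAm
      have h1 : (fun b => A.indicator (1 : Ω → ℝ≥0∞) (S b p)) = {b | S b p ∈ A}.indicator 1 := by
        ext b; simp [indicator]
      rw [h1, lintegral_indicator_one hm, Measure.restrict_apply hm, inter_comm]
      rfl
    · rintro b ⟨hb, R, hRF, hR⟩
      refine ⟨R, hRF, ?_, ?_⟩
      · simp_rw [hS.map_add] at hR
        simp_rw [add_comm b]
        exact hR.le
      · rintro _ ⟨a, ha, rfl⟩
        have h1 := hr R hRF ha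
        rw [mem_ball_zero_iff] at h1 hb ⊢
        exact (norm_add_le _ _).trans_lt (by linarith)
  have hint : t * (volume (Metric.ball (0 : EuclideanSpace ℝ (Fin d)) r) * P A) ≤
      C * (volume (Metric.ball (0 : EuclideanSpace ℝ (Fin d)) (2 * r)) * ∫⁻ p, h p ∂P) := by
    have h1 := hS.lintegral_lintegral_comp (volume.restrict (Metric.ball 0 r))
      (h := A.indicator 1) (measurable_one.indicator hAm)
    have h2 := hS.lintegral_lintegral_comp (volume.restrict (Metric.ball 0 (2 * r))) hh
    rw [lintegral_indicator_one hAm, Measure.restrict_apply_univ] at h1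
    rw [Measure.restrict_apply_univ] at h2
    rw [← h1, ← h2, ← lintegral_const_mul _ (hS.measurable_setLIntegral
      (measurable_one.indicator hAm) _), ← lintegral_const_mul _ (hS.measurable_setLIntegral hh _)]
    exact lintegral_mono hcover
  have hvol : volume (Metric.ball (0 : EuclideanSpace ℝ (Fin d)) (2 * r)) =
      2 ^ d * volume (Metric.ball (0 : EuclideanSpace ℝ (Fin d)) r) := by
    rw [Measure.addHaar_ball_mul_of_pos _ _ (by norm_num : (0 : ℝ) < 2), finrank_euclideanSpace_fin,
      ENNReal.ofReal_pow (by norm_num)]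
    simp
  rw [hvol] at hint
  set v := volume (Metric.ball (0 : EuclideanSpace ℝ (Fin d)) r)
  have hv0 : v ≠ 0 := (Metric.measure_ball_pos _ _ hr0).ne'
  have hvt : v ≠ ∞ := measure_ball_lt_top.ne
  refine (ENNReal.mul_le_mul_iff_right hv0 hvt).1 ?_
  calc v * (t * P A) = t * (v * P A) := by ring
    _ ≤ _ := hint
    _ = _ := by ring

/-- Maximal inequality. -/
theorem maximal (hS : IsPreservingAction S P) (hU : IsVitaliFolner U) {C : ℝ≥0}
    (hC : ∀ R, 0 < R → volume (U R - U R) ≤ C * volume (U R)) {h : Ω → ℝ≥0∞}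
    (hh : Measurable h) (t : ℝ≥0∞) :
    t * P {p | ∃ R, 0 < R ∧ t * volume (U R) < ∫⁻ a in U R, h (S a p)} ≤
      C * 2 ^ d * ∫⁻ p, h p ∂P := by
  classical
  obtain ⟨q, hq⟩ := exists_surjective_nat ℚ
  -- Rational radii suffice by left continuity, and they are exhausted by finite sets with a bound
  -- independent of the set.
  let F : ℕ → Finset ℝ := fun n => ((Finset.range n).image fun i => (q i : ℝ)).filter (0 < ·)
  have hFmono : Monotone F := fun a b hab =>
    Finset.filter_subset_filter _ (Finset.image_subset_image (Finset.range_mono hab))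
  let A : ℕ → Set Ω := fun n => {p | ∃ R ∈ F n, t * volume (U R) < ∫⁻ a in U R, h (S a p)}
  have hAmono : Monotone A := fun a b hab p ⟨R, hR, hp⟩ => ⟨R, hFmono hab hR, hp⟩
  have hsub : {p | ∃ R, 0 < R ∧ t * volume (U R) < ∫⁻ a in U R, h (S a p)} ⊆ ⋃ n, A n := by
    rintro p ⟨R, hR, hp⟩
    obtain ⟨x, hx, hxp⟩ := hU.exists_rat_lt_setLIntegral hR hp
    obtain ⟨i, rfl⟩ := hq x
    refine mem_iUnion.2 ⟨i + 1, q i, Finset.mem_filter.2 ⟨?_, hx⟩, hxp⟩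
    exact Finset.mem_image_of_mem _ (Finset.self_mem_range_succ i)
  calc t * P {p | ∃ R, 0 < R ∧ t * volume (U R) < ∫⁻ a in U R, h (S a p)}
      ≤ t * P (⋃ n, A n) := by gcongr
    _ = ⨆ n, t * P (A n) := by rw [hAmono.measure_iUnion, ENNReal.mul_iSup]
    _ ≤ _ := iSup_le fun n => hS.maximal_finset hU hC hh t fun R hR => (Finset.mem_filter.1 hR).2

end IsPreservingAction

/-! ### Functions whose orbit averages converge -/

section Averages

variable {d : ℕ} {Ω : Type*} [MeasurableSpace Ω] {S : EuclideanSpace ℝ (Fin d) → Ω → Ω}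
  {P : Measure Ω} {U : ℝ → Set (EuclideanSpace ℝ (Fin d))}

/-- The averages of `f` along almost every orbit converge. -/
def HasAverages (S : EuclideanSpace ℝ (Fin d) → Ω → Ω) (P : Measure Ω)
    (U : ℝ → Set (EuclideanSpace ℝ (Fin d))) (f : Ω → ℝ) : Prop :=
  ∀ᵐ p ∂P, ∃ l, Tendsto (fun R : ℝ => ⨍ a in U R, f (S a p)) atTop (𝓝 l)

theorem HasAverages.const_smul {f : Ω → ℝ} (hfa : HasAverages S P U f) (c : ℝ) :
    HasAverages S P U (c • f) := by
  filter_upwards [hfa] with p ⟨l, hl⟩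
  refine ⟨c * l, (hl.const_mul c).congr fun R => ?_⟩
  simp only [setAverage_eq, Pi.smul_apply, integral_const_mul, smul_eq_mul]
  ring

theorem abs_setIntegral_sub_setIntegral_le {α : Type*} [MeasurableSpace α] {μ : Measure α}
    {A B : Set α} (hA : MeasurableSet A) (hB : MeasurableSet B) (hA' : μ A ≠ ∞) (hB' : μ B ≠ ∞)
    {k : α → ℝ} (hk : Measurable k) {M : ℝ} (hkM : ∀ a, |k a| ≤ M) :
    |∫ a in A, k a ∂μ - ∫ a in B, k a ∂μ| ≤ M * μ.real (A ∆ B) := by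
  have hint : ∀ s, μ s ≠ ∞ → IntegrableOn k s μ := fun s hs =>
    Measure.integrableOn_of_bounded (M := M) hs hk.aestronglyMeasurable
      (Eventually.of_forall hkM)
  rw [← integral_inter_add_sdiff hB (hint A hA'), ← integral_inter_add_sdiff hA (hint B hB'),
    inter_comm B A, add_sub_add_left_eq_sub]
  have h1 := norm_setIntegral_le_of_norm_le_const
    ((measure_mono (sdiff_le : A \ B ≤ A)).trans_lt hA'.lt_top) (f := k) (C := M) fun a _ => hkM a
  have h2 := norm_setIntegral_le_of_norm_le_const
    ((measure_mono (sdiff_le : B \ A ≤ B)).trans_lt hB'.lt_top) (f := k) (C := M) fun a _ => hkM a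
  rw [Real.norm_eq_abs] at h1 h2
  refine (abs_sub _ _).trans ((add_le_add h1 h2).trans ?_)
  rw [← mul_add, Set.symmDiff_def, measureReal_union
    (disjoint_sdiff_sdiff) (hB.diff hA) (ne_top_of_le_ne_top hA' (measure_mono sdiff_le))
    (ne_top_of_le_ne_top hB' (measure_mono sdiff_le))]

/-- The averages of a coboundary tend to zero along every orbit. -/
theorem hasAverages_coboundary (hS : IsPreservingAction S P) (hU : IsVitaliFolner U) {A : Set Ω}
    (hA : MeasurableSet A) (b : EuclideanSpace ℝ (Fin d)) :
    HasAverages S P U (A.indicator 1 - (S b ⁻¹' A).indicator 1) := by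
  refine Eventually.of_forall fun p => ⟨0, ?_⟩
  have hfol := (ENNReal.tendsto_toReal ENNReal.zero_ne_top).comp (hU.folner b)
  refine squeeze_zero_norm' ?_ hfol
  filter_upwards [eventually_gt_atTop 0] with R hR
  have hRm := (hU.isOpen R hR).measurableSet
  have hv : 0 < volume.real (U R) :=
    ENNReal.toReal_pos (hU.volume_pos hR).ne' (hU.volume_ne_top hR)
  let k : EuclideanSpace ℝ (Fin d) → ℝ := fun a => A.indicator 1 (S a p)
  have hkm : Measurable k :=
    (measurable_one.indicator hA).comp (hS.measurable.comp measurable_prodMk_right)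
  have hk1 : ∀ a, |k a| ≤ 1 := fun a => by
    simp only [k, indicator]; split_ifs <;> simp
  have hki : ∀ s : Set (EuclideanSpace ℝ (Fin d)), volume s ≠ ∞ → IntegrableOn k s := fun s hs =>
    Measure.integrableOn_of_bounded (M := 1) hs hkm.aestronglyMeasurable
      (Eventually.of_forall hk1)
  have hkb : ∀ a, (A.indicator 1 - (S b ⁻¹' A).indicator 1 : Ω → ℝ) (S a p) = k a - k (b + a) := by
    intro a
    simp only [k, Pi.sub_apply, ← hS.map_add b a p]
    rfl
  -- The coboundary integrates to the difference of integrals over `U R` and its translate, at most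
  -- the volume of their symmetric difference, which is negligible by the Følner property.
  have htrans : ∫ a in U R, k (b + a) = ∫ a in b +ᵥ U R, k a :=
    (measurePreserving_add_left (volume : Measure (EuclideanSpace ℝ (Fin d))) b).setIntegral_image_emb
      (MeasurableEquiv.addLeft b).measurableEmbedding k (U R) |>.symm
  have hkbi : IntegrableOn (fun a => k (b + a)) (U R) :=
    Measure.integrableOn_of_bounded (M := 1) (hU.volume_ne_top hR)
      (hkm.comp (measurable_const_add b)).aestronglyMeasurable (Eventually.of_forall fun a => hk1 _)
  simp only [hkb, setAverage_eq]
  rw [integral_sub (hki _ (hU.volume_ne_top hR)) hkbi, htrans]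
  have := abs_setIntegral_sub_setIntegral_le (μ := volume) hRm (hRm.const_vadd b)
    (hU.volume_ne_top hR) (by rw [measure_vadd]; exact hU.volume_ne_top hR) hkm hk1
  rw [norm_smul, norm_inv, Real.norm_of_nonneg hv.le, Real.norm_eq_abs, inv_mul_le_iff₀ hv]
  refine this.trans (le_of_eq ?_)
  rw [one_mul, symmDiff_comm, Function.comp_apply, ENNReal.toReal_div]
  exact (mul_div_cancel₀ _ hv.ne').symm

variable [IsProbabilityMeasure P]

/-- A single null set serves all radii: Fubini treats the countably many balls of integer radius,
and each `U R` is contained in one of them. -/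
theorem IsPreservingAction.ae_integrableOn (hS : IsPreservingAction S P) (hU : IsVitaliFolner U)
    {f : Ω → ℝ} (hf : Measurable f) (hfi : Integrable f P) :
    ∀ᵐ p ∂P, ∀ R, 0 < R → IntegrableOn (fun a => f (S a p)) (U R) := by
  have hk : ∀ k : ℕ, ∀ᵐ p ∂P, ∫⁻ a in Metric.ball 0 (k : ℝ), ‖f (S a p)‖ₑ < ∞ := fun k => by
    refine ae_lt_top (hS.measurable_setLIntegral hf.enorm _) ?_
    rw [hS.lintegral_lintegral_comp _ hf.enorm, Measure.restrict_apply_univ]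
    exact ENNReal.mul_ne_top measure_ball_lt_top.ne hfi.2.ne
  filter_upwards [ae_all_iff.2 hk] with p hp R hR
  obtain ⟨r, hr⟩ := (hU.isBounded R hR).subset_ball 0
  obtain ⟨k, hk⟩ := exists_nat_ge r
  have hm : Measurable fun a => f (S a p) := hf.comp (hS.measurable.comp measurable_prodMk_right)
  exact ⟨hm.aestronglyMeasurable, lt_of_le_of_lt
    (lintegral_mono_set (hr.trans (Metric.ball_subset_ball hk))) (hp k)⟩

/-- The class of functions whose averages converge is closed in `L¹`. -/
theorem HasAverages.of_approx (hS : IsPreservingAction S P) (hU : IsVitaliFolner U) {f : Ω → ℝ}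
    (hf : Measurable f) (hfi : Integrable f P)
    (happ : ∀ η : ℝ≥0, 0 < η → ∃ g : Ω → ℝ, Measurable g ∧ Integrable g P ∧
      HasAverages S P U g ∧ ∫⁻ p, ‖f p - g p‖ₑ ∂P ≤ η) : HasAverages S P U f := by
  obtain ⟨C, hC⟩ := hU.volume_sub_le
  -- Banach's principle. In `3 * t`, two terms `t` come from replacing `f` by `g`, outside the set
  -- where the maximal function of `|f - g|` exceeds `t`; the third from the convergent averages of
  -- `g`. The maximal inequality bounds the measure of the bad set by a multiple of `η / t` for
  -- every `η`, so it is null.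
  let good : ℝ → Ω → Prop := fun t p => ∃ R₀ : ℝ, ∀ R ≥ R₀, ∀ R' ≥ R₀,
    dist (⨍ a in U R, f (S a p)) (⨍ a in U R', f (S a p)) ≤ 3 * t
  have key : ∀ t : ℝ, 0 < t → ∀ᵐ p ∂P, good t p := by
    intro t ht
    have hle : ∀ η : ℝ≥0, 0 < η → ENNReal.ofReal t * P {p | ¬ good t p} ≤ C * 2 ^ d * η := by
      intro η hη
      obtain ⟨g, hg, hgi, hga, hfg⟩ := happ η hη
      refine le_trans ?_ ((hS.maximal hU hC (hf.sub hg).enorm (ENNReal.ofReal t)).trans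
        (mul_le_mul_right hfg _))
      refine mul_le_mul_right (measure_mono_ae ?_) _
      filter_upwards [hga, hS.ae_integrableOn hU hf hfi, hS.ae_integrableOn hU hg hgi]
        with p hl hfp hgp
      intro hbad
      by_contra hmax
      refine hbad ?_
      have hmax' : ∀ R, 0 < R → ∫⁻ a in U R, ‖(f - g) (S a p)‖ₑ ≤
          ENNReal.ofReal t * volume (U R) := fun R hR => by
        by_contra! hlt
        exact hmax ⟨R, hR, hlt⟩
      have hdist : ∀ R, 0 < R → dist (⨍ a in U R, f (S a p)) (⨍ a in U R, g (S a p)) ≤ t := by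
        intro R hR
        have hv : 0 < volume.real (U R) :=
          ENNReal.toReal_pos (hU.volume_pos hR).ne' (hU.volume_ne_top hR)
        rw [setAverage_eq, setAverage_eq, dist_eq_norm, ← smul_sub,
          ← integral_sub (hfp R hR) (hgp R hR), norm_smul, norm_inv, Real.norm_of_nonneg hv.le,
          inv_mul_le_iff₀ hv]
        have h1 := (enorm_integral_le_lintegral_enorm (μ := volume.restrict (U R))
          fun a => f (S a p) - g (S a p)).trans (hmax' R hR)
        rw [← ofReal_norm, ← ENNReal.ofReal_toReal (hU.volume_ne_top hR),
          ← ENNReal.ofReal_mul ht.le] at h1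
        have := (ENNReal.ofReal_le_ofReal_iff (by positivity)).1 h1
        rwa [mul_comm]
      obtain ⟨l, hl⟩ := hl
      obtain ⟨R₁, hR₁⟩ := eventually_atTop.1
        (hl.eventually (Metric.ball_mem_nhds l (half_pos ht)))
      refine ⟨max R₁ 1, fun R hR R' hR' => ?_⟩
      have hR0 : 0 < R := zero_lt_one.trans_le ((le_max_right _ _).trans hR)
      have hR0' : 0 < R' := zero_lt_one.trans_le ((le_max_right _ _).trans hR')
      have a1 := hdist R hR0
      have a2 := hdist R' hR0'
      have a3 := hR₁ R ((le_max_left _ _).trans hR)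
      have a4 := hR₁ R' ((le_max_left _ _).trans hR')
      have a5 := dist_triangle4 (⨍ a in U R, f (S a p)) (⨍ a in U R, g (S a p))
        (⨍ a in U R', g (S a p)) (⨍ a in U R', f (S a p))
      have a6 := dist_triangle_right (⨍ a in U R, g (S a p)) (⨍ a in U R', g (S a p)) l
      rw [dist_comm] at a2
      linarith
    have hzero : ENNReal.ofReal t * P {p | ¬ good t p} ≤ 0 := by
      refine ENNReal.le_of_forall_pos_le_add fun e he _ => ?_
      refine (hle (e / (C * 2 ^ d + 1)) (by positivity)).trans ?_
      rw [zero_add]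
      have : C * 2 ^ d * (e / (C * 2 ^ d + 1)) ≤ e := by
        rw [mul_div_assoc']
        exact div_le_of_le_mul₀ (by positivity) (by positivity) (by
          rw [mul_comm]; gcongr; exact le_self_add)
      exact_mod_cast this
    rw [ae_iff]
    rcases mul_eq_zero.1 (nonpos_iff_eq_zero.1 hzero) with h | h
    · simp [ht.not_ge] at h
    · exact h
  have hall : ∀ᵐ p ∂P, ∀ n : ℕ, good (1 / ((n : ℝ) + 1)) p :=
    ae_all_iff.2 fun n => key _ (by positivity)
  filter_upwards [hall] with p hp
  refine cauchySeq_tendsto_of_complete (Metric.cauchySeq_iff.2 fun e he => ?_)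
  obtain ⟨n, hn⟩ := exists_nat_one_div_lt (show 0 < e / 3 by positivity)
  obtain ⟨R₀, hR₀⟩ := hp n
  exact ⟨R₀, fun R hR R' hR' => (hR₀ R hR R' hR').trans_lt (by linarith)⟩

/-- Orbits may cross the null set where the functions differ; this is absorbed as an approximation
with zero $L^1$ error. -/
theorem HasAverages.congr (hS : IsPreservingAction S P) (hU : IsVitaliFolner U) {f g : Ω → ℝ}
    (hf : Measurable f) (hg : Measurable g) (hgi : Integrable g P) (hga : HasAverages S P U g)
    (hfg : f =ᵐ[P] g) : HasAverages S P U f := by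
  refine HasAverages.of_approx hS hU hf (hgi.congr hfg.symm) fun η _ => ⟨g, hg, hgi, hga, ?_⟩
  have : ∫⁻ p, ‖f p - g p‖ₑ ∂P = ∫⁻ p, 0 ∂P :=
    lintegral_congr_ae (hfg.mono fun p hp => by simp [hp])
  simp [this]

theorem HasAverages.add (hS : IsPreservingAction S P) (hU : IsVitaliFolner U) {f g : Ω → ℝ}
    (hf : Measurable f) (hfi : Integrable f P) (hfa : HasAverages S P U f)
    (hg : Measurable g) (hgi : Integrable g P) (hga : HasAverages S P U g) :
    HasAverages S P U (f + g) := by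
  filter_upwards [hfa, hga, hS.ae_integrableOn hU hf hfi, hS.ae_integrableOn hU hg hgi]
    with p ⟨l, hl⟩ ⟨m, hm⟩ hfp hgp
  refine ⟨l + m, (hl.add hm).congr' ?_⟩
  filter_upwards [eventually_gt_atTop 0] with R hR
  simp only [setAverage_eq, Pi.add_apply]
  rw [integral_add (hfp R hR) (hgp R hR), smul_add]

/-- The exceptional set in the invariance depends on `b`; Fubini turns this into constancy of `z` at
almost every point of almost every orbit, which is all that averages see. -/
theorem hasAverages_of_invariant (hS : IsPreservingAction S P) (hU : IsVitaliFolner U)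
    {z : Ω → ℝ} (hz : Measurable z) (hinv : ∀ b, (fun p => z (S b p)) =ᵐ[P] z) :
    HasAverages S P U z := by
  have hm : MeasurableSet {x : EuclideanSpace ℝ (Fin d) × Ω | z (S x.1 x.2) = z x.2} :=
    measurableSet_eq_fun (hz.comp hS.measurable) (hz.comp measurable_snd)
  have hae : ∀ᵐ p ∂P, ∀ᵐ a ∂(volume : Measure (EuclideanSpace ℝ (Fin d))), z (S a p) = z p :=
    (Measure.ae_ae_comm hm).1 (Eventually.of_forall fun a => hinv a)
  filter_upwards [hae] with p hp
  refine ⟨z p, tendsto_const_nhds.congr' ?_⟩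
  filter_upwards [eventually_gt_atTop 0] with R hR
  rw [setAverage_congr_fun (g := fun _ => z p) (hU.isOpen R hR).measurableSet
    (hp.mono fun a ha _ => ha), setAverage_const (hU.volume_pos hR).ne' (hU.volume_ne_top hR)]

end Averages

/-! ### The pointwise ergodic theorem -/

section Ergodic

variable {d : ℕ} {Ω : Type*} [MeasurableSpace Ω] {S : EuclideanSpace ℝ (Fin d) → Ω → Ω}
  {P : Measure Ω} {U : ℝ → Set (EuclideanSpace ℝ (Fin d))}

theorem HasAverages.zero : HasAverages S P U 0 :=
  Eventually.of_forall fun p => ⟨0, by simp⟩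

variable [IsProbabilityMeasure P]

/-- A change of variables turns the integral of `z ∘ S b` over `A` into that of `z` over the
preimage of `A` under `S (-b)`, which the hypothesis identifies with the integral of `z` over `A`.
-/
theorem IsPreservingAction.comp_ae_eq_of_setIntegral_eq (hS : IsPreservingAction S P) {z : Ω → ℝ}
    (hz : Measurable z) (hzi : Integrable z P)
    (h : ∀ b A, MeasurableSet A → ∫ p in A, z p ∂P = ∫ p in S b ⁻¹' A, z p ∂P)
    (b : EuclideanSpace ℝ (Fin d)) : (fun p => z (S b p)) =ᵐ[P] z := by
  have hzb : Integrable (fun p => z (S b p)) P := (hS.preserving b).integrable_comp_of_integrable hzi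
  refine ae_eq_of_forall_setIntegral_eq_of_sigmaFinite (fun _ _ _ => hzb.integrableOn)
    (fun _ _ _ => hzi.integrableOn) fun A hA _ => ?_
  have hAb : S b ⁻¹' (S (-b) ⁻¹' A) = A := by
    ext p
    simp [hS.map_add, hS.map_zero]
  have h1 := setIntegral_map (μ := P) (g := S b) (f := z)
    ((hS.preserving (-b)).measurable hA) hz.aestronglyMeasurable
    (hS.preserving b).measurable.aemeasurable
  rw [(hS.preserving b).map_eq, hAb] at h1
  rw [← h1, h (-b) A hA]

/-- Von Neumann's splitting: a function orthogonal to the coboundaries of all indicators has equal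
integrals over `A` and `S b ⁻¹' A`, hence is invariant. So $L^2$ is the sum of the closed span of
coboundaries, handled by approximation, and a space of invariant functions. -/
theorem hasAverages_L2 (hS : IsPreservingAction S P) (hU : IsVitaliFolner U) (f : Lp ℝ 2 P) :
    HasAverages S P U f := by
  let cob : Set (Lp ℝ 2 P) := {y | ∃ (A : Set Ω) (hA : MeasurableSet A)
    (b : EuclideanSpace ℝ (Fin d)), y = indicatorConstLp 2 hA (measure_ne_top P A) 1 -
      indicatorConstLp 2 ((hS.preserving b).measurable hA) (measure_ne_top P _) 1}
  have hm : ∀ y : Lp ℝ 2 P, Measurable y := fun y => (Lp.stronglyMeasurable y).measurable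
  have hi : ∀ y : Lp ℝ 2 P, Integrable y P := fun y => (Lp.memLp y).integrable (by norm_num)
  have hspan : ∀ y ∈ Submodule.span ℝ cob, HasAverages S P U y := by
    intro y hy
    induction hy using Submodule.span_induction with
    | mem y hy =>
      obtain ⟨A, hA, b, rfl⟩ := hy
      have hA' := (hS.preserving b).measurable hA
      refine (hasAverages_coboundary hS hU hA b).congr hS hU (hm _)
        ((measurable_one.indicator hA).sub (measurable_one.indicator hA'))
        (((integrable_const 1).indicator hA).sub ((integrable_const 1).indicator hA')) ?_
      filter_upwards [Lp.coeFn_sub (indicatorConstLp 2 hA (measure_ne_top P A) (1 : ℝ))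
        (indicatorConstLp 2 hA' (measure_ne_top P _) (1 : ℝ)),
        indicatorConstLp_coeFn (p := 2) (hs := hA) (hμs := measure_ne_top P A) (c := (1 : ℝ)),
        indicatorConstLp_coeFn (p := 2) (hs := hA') (hμs := measure_ne_top P _) (c := (1 : ℝ))]
        with p h1 h2 h3
      rw [h1, Pi.sub_apply, h2, h3]
      rfl
    | zero =>
      exact HasAverages.zero.congr hS hU (hm _) measurable_zero (integrable_zero _ _ _)
        (Lp.coeFn_zero ℝ 2 P)
    | add x y _ _ hx hy =>
      exact (hx.add hS hU (hm x) (hi x) (hm y) (hi y) hy).congr hS hU (hm _) ((hm x).add (hm y))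
        ((hi x).add (hi y)) (Lp.coeFn_add x y)
    | smul c x _ hx =>
      exact (hx.const_smul c).congr hS hU (hm _) ((hm x).const_smul c) ((hi x).smul c)
        (Lp.coeFn_smul c x)
  let K := (Submodule.span ℝ cob).topologicalClosure
  have : CompleteSpace K := (Submodule.isClosed_topologicalClosure _).completeSpace_coe
  obtain ⟨y, hy, z, hz, rfl⟩ := K.exists_add_mem_mem_orthogonal f
  have hzA : ∀ b A, MeasurableSet A → ∫ p in A, z p ∂P = ∫ p in S b ⁻¹' A, z p ∂P := by
    intro b A hA
    have hA' := (hS.preserving b).measurable hA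
    have := hz _ ((Submodule.span ℝ cob).le_topologicalClosure
      (Submodule.subset_span ⟨A, hA, b, rfl⟩))
    rw [inner_sub_left, L2.inner_indicatorConstLp_one, L2.inner_indicatorConstLp_one] at this
    exact sub_eq_zero.1 this
  have hza := hasAverages_of_invariant hS hU (hm z)
    (hS.comp_ae_eq_of_setIntegral_eq (hm z) (hi z) hzA)
  have hya : HasAverages S P U y := by
    refine HasAverages.of_approx hS hU (hm y) (hi y) fun η hη => ?_
    have hy' : y ∈ closure (Submodule.span ℝ cob : Set (Lp ℝ 2 P)) := hy
    obtain ⟨x, hx, hxy⟩ := EMetric.mem_closure_iff.1 hy' η (by exact_mod_cast hη)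
    refine ⟨x, hm x, hi x, hspan x hx, ?_⟩
    rw [Lp.edist_def] at hxy
    refine le_trans ?_ hxy.le
    rw [← eLpNorm_one_eq_lintegral_enorm]
    exact eLpNorm_le_eLpNorm_of_exponent_le (by norm_num)
      ((hm y).sub (hm x)).aestronglyMeasurable
  exact (hya.add hS hU (hm y) (hi y) (hm z) (hi z) hza).congr hS hU (hm _) ((hm y).add (hm z))
    ((hi y).add (hi z)) (Lp.coeFn_add y z)

/-- Pointwise ergodic theorem for real integrable functions: existence of the limit. -/
theorem hasAverages_of_integrable (hS : IsPreservingAction S P) (hU : IsVitaliFolner U)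
    {f : Ω → ℝ} (hf : Measurable f) (hfi : Integrable f P) : HasAverages S P U f := by
  refine HasAverages.of_approx hS hU hf hfi fun η hη => ?_
  -- Simple functions are dense in $L^1$ and, `P` being finite, belong to $L^2$.
  obtain ⟨g, hg, -⟩ := (memLp_one_iff_integrable.2 hfi).exists_simpleFunc_eLpNorm_sub_lt
    ENNReal.one_ne_top (ε := η) (by exact_mod_cast hη.ne')
  have hg2 : MemLp g 2 P := g.memLp_of_isFiniteMeasure 2 P
  refine ⟨g, g.measurable, hg2.integrable (by norm_num), ?_, ?_⟩
  · exact (hasAverages_L2 hS hU hg2.toLp).congr hS hU g.measurable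
      (Lp.stronglyMeasurable _).measurable ((Lp.memLp _).integrable (by norm_num))
      hg2.coeFn_toLp.symm
  · rw [eLpNorm_one_eq_lintegral_enorm] at hg
    exact hg.le

/-- Pointwise ergodic theorem for nonnegative functions of finite integral. -/
theorem exists_tendsto_setLAverage (hS : IsPreservingAction S P) (hU : IsVitaliFolner U)
    {f : Ω → ℝ≥0∞} (hf : Measurable f) (hfi : ∫⁻ p, f p ∂P ≠ ∞) :
    ∃ g : Ω → ℝ≥0∞, Measurable g ∧
      (∀ᵐ p ∂P, Tendsto (fun R : ℝ => ⨍⁻ a in U R, f (S a p) ∂volume) atTop (𝓝 (g p))) ∧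
      ∫⁻ p, f p ∂P = ∫⁻ p, g p ∂P := by
  have hmeas : ∀ {h : Ω → ℝ≥0∞}, Measurable h → ∀ n : ℕ,
      Measurable fun p => ⨍⁻ a in U (n + 1 : ℝ), h (S a p) ∂volume := fun hh n => by
    simp only [setLAverage_eq]
    exact (hS.measurable_setLIntegral hh _).div_const _
  have hint : ∀ {h : Ω → ℝ≥0∞}, Measurable h → ∀ n : ℕ,
      ∫⁻ p, ⨍⁻ a in U (n + 1 : ℝ), h (S a p) ∂volume ∂P = ∫⁻ p, h p ∂P := fun hh n => by
    have hn : (0 : ℝ) < n + 1 := by positivity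
    simp only [setLAverage_eq, div_eq_mul_inv]
    rw [lintegral_mul_const _ (hS.measurable_setLIntegral hh _), hS.lintegral_lintegral_comp _ hh,
      Measure.restrict_apply_univ, mul_comm, ← mul_assoc,
      ENNReal.inv_mul_cancel (hU.volume_pos hn).ne' (hU.volume_ne_top hn), one_mul]
  -- A liminf along integer radii makes the limit measurable; `n + 1` keeps the radii positive.
  let g : Ω → ℝ≥0∞ := fun p => liminf (fun n : ℕ => ⨍⁻ a in U (n + 1 : ℝ), f (S a p) ∂volume) atTop
  have hfin : ∀ᵐ p ∂P, f p < ∞ := ae_lt_top hf hfi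
  have hfr : Measurable fun p => (f p).toReal := hf.ennreal_toReal
  have hfri : Integrable (fun p => (f p).toReal) P := integrable_toReal_of_lintegral_ne_top
    hf.aemeasurable hfi
  have hSfin : ∀ᵐ p ∂P, ∀ᵐ a ∂(volume : Measure (EuclideanSpace ℝ (Fin d))), f (S a p) < ∞ := by
    have hm : MeasurableSet {x : EuclideanSpace ℝ (Fin d) × Ω | f (S x.1 x.2) < ∞} :=
      measurableSet_lt (hf.comp hS.measurable) measurable_const
    exact (Measure.ae_ae_comm hm).1 (Eventually.of_forall fun a =>
      (hS.preserving a).quasiMeasurePreserving.ae hfin)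
  have hlim : ∀ᵐ p ∂P, Tendsto (fun R : ℝ => ⨍⁻ a in U R, f (S a p) ∂volume) atTop (𝓝 (g p)) := by
    filter_upwards [hasAverages_of_integrable hS hU hfr hfri, hSfin,
      hS.ae_integrableOn hU hfr hfri] with p ⟨l, hl⟩ hp hpi
    have hconv : Tendsto (fun R : ℝ => ⨍⁻ a in U R, f (S a p) ∂volume) atTop (𝓝 (ENNReal.ofReal l)) := by
      refine (ENNReal.tendsto_ofReal hl).congr' ?_
      filter_upwards [eventually_gt_atTop 0] with R hR
      have hv : 0 < volume.real (U R) :=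
        ENNReal.toReal_pos (hU.volume_pos hR).ne' (hU.volume_ne_top hR)
      rw [setAverage_eq, setLAverage_eq, smul_eq_mul, ENNReal.ofReal_mul (by positivity),
        ENNReal.ofReal_inv_of_pos hv, ofReal_measureReal (hU.volume_ne_top hR),
        ofReal_integral_eq_lintegral_ofReal (hpi R hR)
          (Eventually.of_forall fun _ => ENNReal.toReal_nonneg), mul_comm, div_eq_mul_inv]
      congr 1
      refine lintegral_congr_ae (ae_restrict_of_ae (hp.mono fun a ha => ?_))
      exact ENNReal.ofReal_toReal ha.ne
    have hg : g p = ENNReal.ofReal l :=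
      (hconv.comp (tendsto_atTop_add_const_right atTop (1 : ℝ)
        tendsto_natCast_atTop_atTop)).liminf_eq
    rwa [hg]
  refine ⟨g, Measurable.liminf (hmeas hf), hlim, le_antisymm ?_ ?_⟩
  -- Averaging preserves integrals, so reverse Fatou, legitimate for the truncation at `M`, gives
  -- this inequality; the opposite one is Fatou's lemma.
  · have hM : ∀ M : ℕ, ∫⁻ p, min (f p) M ∂P ≤ ∫⁻ p, g p ∂P := by
      intro M
      have hfM : Measurable fun p => min (f p) (M : ℝ≥0∞) := hf.min measurable_const
      have hle : ∀ n : ℕ, ∀ p, ⨍⁻ a in U (n + 1 : ℝ), min (f (S a p)) (M : ℝ≥0∞) ∂volume ≤ M := by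
        intro n p
        have hn : (0 : ℝ) < n + 1 := by positivity
        rw [setLAverage_eq]
        refine ENNReal.div_le_of_le_mul ((lintegral_mono fun _ => min_le_right _ _).trans ?_)
        simp
      have h1 := limsup_lintegral_le (μ := P) (g := fun _ => (M : ℝ≥0∞)) (hmeas hfM)
        (fun n => Eventually.of_forall fun p => hle n p) (by simp)
      simp only [hint hfM, limsup_const] at h1
      refine h1.trans (lintegral_mono_ae ?_)
      filter_upwards [hlim] with p hp
      have h2 : limsup (fun n : ℕ => ⨍⁻ a in U (n + 1 : ℝ), f (S a p) ∂volume) atTop = g p :=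
        (hp.comp (tendsto_atTop_add_const_right atTop (1 : ℝ)
          tendsto_natCast_atTop_atTop)).limsup_eq
      rw [← h2]
      refine limsup_le_limsup (Eventually.of_forall fun n => ?_)
      simp only [setLAverage_eq]
      gcongr
      exact min_le_left _ _
    have hsup : ∀ p, f p = ⨆ n : ℕ, min (f p) (n : ℝ≥0∞) := fun p => by
      refine le_antisymm (le_of_forall_lt fun c hc => ?_) (iSup_le fun n => min_le_left _ _)
      obtain ⟨n, hn⟩ := ENNReal.exists_nat_gt (ne_top_of_lt hc)
      exact lt_iSup_iff.2 ⟨n, lt_min hc hn⟩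
    rw [lintegral_congr hsup, lintegral_iSup (fun n => hf.min measurable_const)
      fun a b hab p => min_le_min le_rfl (by simpa using hab)]
    exact iSup_le hM
  · refine (lintegral_liminf_le (hmeas hf)).trans ?_
    simp only [hint hf, liminf_const, le_refl]

end Ergodic

/-! ### Local energies and low-energy sets -/

section Energy

variable {d : ℕ} {X : Type*} [TopologicalSpace X] [PolishSpace X] [MeasurableSpace X]
  [BorelSpace X] {θ : EuclideanSpace ℝ (Fin d) → X → X} {G : Set (EuclideanSpace ℝ (Fin d))}

theorem IsContAction.measurable_uncurry (hθ : IsContAction θ) :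
    Measurable (Function.uncurry θ) :=
  measurable_uncurry_of_continuous_of_measurable hθ.continuous_param
    fun a => (hθ.continuous_space a).measurable

theorem lintegral_normLebesgue (hG : IsMacroDomain G) (h : EuclideanSpace ℝ (Fin d) → ℝ≥0∞) :
    ∫⁻ x : G, h x ∂(normLebesgue hG : Measure G) = (volume G)⁻¹ * ∫⁻ x in G, h x := by
  change ∫⁻ x : G, h x ∂((volume G)⁻¹ • lebesgueOn G) = _
  rw [lintegral_smul_measure, lebesgueOn, lintegral_subtype_comap hG.isCompact.measurableSet,
    smul_eq_mul]

theorem integral_normLebesgue (hG : IsMacroDomain G) (h : EuclideanSpace ℝ (Fin d) → ℝ)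
    (hh : ∀ x ∉ G, h x = 0) :
    ∫ x : G, h x ∂(normLebesgue hG : Measure G) = (volume.real G)⁻¹ * ∫ x, h x := by
  change ∫ x : G, h x ∂((volume G)⁻¹ • lebesgueOn G) = _
  rw [integral_smul_measure, lebesgueOn, integral_subtype_comap hG.isCompact.measurableSet,
    setIntegral_eq_integral_of_forall_compl_eq_zero hh, ENNReal.toReal_inv, smul_eq_mul]
  rfl

theorem lintegral_blowupMeasure (hG : IsMacroDomain G) (hθ : IsContAction θ) (ε : ℝ) (u : X)
    {h : G × X → ℝ≥0∞} (hh : Measurable h) :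
    ∫⁻ p, h p ∂(blowupMeasure hG hθ ε u : Measure (G × X)) =
      ∫⁻ x : G, h (x, θ (ε⁻¹ • (x : EuclideanSpace ℝ (Fin d))) u) ∂(normLebesgue hG : Measure G) :=
  lintegral_map hh (continuous_blowup hθ ε u).measurable

theorem macroEnergy_eq_lintegral (hG : IsMacroDomain G) (hθ : IsContAction θ)
    {fε : ℝ → G × X → ℝ≥0∞} {ε : ℝ} (hfε : Measurable (fε ε)) (u : X) :
    macroEnergy θ fε ε u = ∫⁻ p, fε ε p ∂(blowupMeasure hG hθ ε u : Measure (G × X)) := by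
  rw [lintegral_blowupMeasure hG hθ ε u hfε]
  change _ = ∫⁻ x : G, _ ∂((volume G)⁻¹ • lebesgueOn G)
  rw [macroEnergy, laverage_eq, lintegral_smul_measure, smul_eq_mul, div_eq_mul_inv, mul_comm,
    lebesgueOn, comap_subtype_coe_apply hG.isCompact.measurableSet, image_univ, Subtype.range_coe]

omit [TopologicalSpace X] [PolishSpace X] [BorelSpace X] in
theorem measurable_zeroExt (hG : MeasurableSet G) {h : G × X → ℝ≥0∞} (hh : Measurable h) :
    Measurable (zeroExt G h) := by
  classical
  have hs : MeasurableSet {p : EuclideanSpace ℝ (Fin d) × X | p.1 ∈ G} := measurable_fst hG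
  have := Measurable.dite (s := {p : EuclideanSpace ℝ (Fin d) × X | p.1 ∈ G})
    (f := fun q => h (⟨q.1.1, q.2⟩, q.1.2)) (g := fun _ => 0)
    (hh.comp (Measurable.prodMk
      (Measurable.subtype_mk (measurable_fst.comp measurable_subtype_coe))
      (measurable_snd.comp measurable_subtype_coe))) measurable_const hs
  convert this using 1
  ext p
  simp only [zeroExt]
  congr

/-- The energy of `p` in the ball of radius `R` at scale `ε`. -/
noncomputable def localEnergy (θ : EuclideanSpace ℝ (Fin d) → X → X) (fε : ℝ → G × X → ℝ≥0∞)
    (ε R : ℝ) (z : G × X) : ℝ≥0∞ :=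
  ∫⁻ a in Metric.ball (0 : EuclideanSpace ℝ (Fin d)) R,
    zeroExt G (fε ε) (shiftEps θ ε a ((z.1 : EuclideanSpace ℝ (Fin d)), z.2))

theorem measurable_localEnergy (hG : MeasurableSet G) (hθ : IsContAction θ)
    {fε : ℝ → G × X → ℝ≥0∞} {ε : ℝ} (hfε : Measurable (fε ε)) (R : ℝ) :
    Measurable (localEnergy θ fε ε R) := by
  refine Measurable.lintegral_prod_left (f := fun (a : EuclideanSpace ℝ (Fin d)) (z : G × X) =>
    zeroExt G (fε ε) (shiftEps θ ε a ((z.1 : EuclideanSpace ℝ (Fin d)), z.2)))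
    ((measurable_zeroExt hG hfε).comp (Measurable.prodMk ?_ ?_))
  · simp only
    fun_prop
  · exact hθ.measurable_uncurry.comp
      (measurable_fst.prodMk (measurable_snd.comp measurable_snd))

/-- The shift $T^\varepsilon_a$ sends $(x,\theta_{x/\varepsilon}u)$ to the point of the same curve
over $x+\varepsilon a$. The integrand is thus `H (x + ε • a)` for one function `H` vanishing off
`G`; enlarge the domain of `x` to $\mathbb{R}^d$ and use Fubini and translation invariance. -/
theorem lintegral_localEnergy_le (hG : IsMacroDomain G) (hθ : IsContAction θ)
    {fε : ℝ → G × X → ℝ≥0∞} {ε : ℝ} (hε : 0 < ε) (hfε : Measurable (fε ε)) (R : ℝ) (u : X) :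
    ∫⁻ z, localEnergy θ fε ε R z ∂(blowupMeasure hG hθ ε u : Measure (G × X)) ≤
      volume (Metric.ball (0 : EuclideanSpace ℝ (Fin d)) R) * macroEnergy θ fε ε u := by
  have hGm := hG.isCompact.measurableSet
  let H : EuclideanSpace ℝ (Fin d) → ℝ≥0∞ := fun y => zeroExt G (fε ε) (y, θ (ε⁻¹ • y) u)
  have hH : Measurable H := (measurable_zeroExt hGm hfε).comp
    (measurable_id.prodMk (((hθ.continuous_param u).comp (continuous_const_smul ε⁻¹)).measurable))
  have hHz : ∀ y (hy : y ∈ G), H y = fε ε (⟨y, hy⟩, θ (ε⁻¹ • y) u) := fun y hy => by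
    simp [H, zeroExt, hy]
  have hH0 : ∀ y ∉ G, H y = 0 := fun y hy => by simp [H, zeroExt, hy]
  have hloc : ∀ x : G, localEnergy θ fε ε R (x, θ (ε⁻¹ • (x : EuclideanSpace ℝ (Fin d))) u) =
      ∫⁻ a in Metric.ball 0 R, H (x + ε • a) := by
    intro x
    simp only [localEnergy, shiftEps, H, hθ.map_add, smul_add, inv_smul_smul₀ hε.ne']
    simp only [add_comm]
  have hmac : macroEnergy θ fε ε u = (volume G)⁻¹ * ∫⁻ y, H y := by
    rw [macroEnergy_eq_lintegral hG hθ hfε, lintegral_blowupMeasure hG hθ ε u hfε,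
      ← setLIntegral_eq_of_support_subset (s := G), ← lintegral_normLebesgue hG H]
    · exact lintegral_congr fun x => (hHz x x.2).symm
    · intro y hy
      by_contra hyG
      exact hy (hH0 y hyG)
  rw [lintegral_blowupMeasure hG hθ ε u (measurable_localEnergy hGm hθ hfε R), lintegral_congr hloc,
    lintegral_normLebesgue hG (fun x => ∫⁻ a in Metric.ball 0 R, H (x + ε • a)), hmac,
    mul_left_comm]
  gcongr
  calc ∫⁻ x in G, ∫⁻ a in Metric.ball 0 R, H (x + ε • a)
      ≤ ∫⁻ x, ∫⁻ a in Metric.ball 0 R, H (x + ε • a) := setLIntegral_le_lintegral _ _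
    _ = ∫⁻ a in Metric.ball 0 R, ∫⁻ x, H (x + ε • a) :=
        lintegral_lintegral_swap (hH.comp (by fun_prop)).aemeasurable
    _ = _ := by
        simp_rw [lintegral_add_right_eq_self H]
        rw [lintegral_const, Measure.restrict_apply_univ, mul_comm]

/-- Points whose local energies are bounded by a given sequence. -/
def lowEnergySet (θ : EuclideanSpace ℝ (Fin d) → X → X) (fε : ℝ → G × X → ℝ≥0∞)
    (c : ℕ → ℝ≥0∞) (ε : ℝ) : Set (G × X) :=
  {z | ∀ k : ℕ, localEnergy θ fε ε (k + 1) z ≤ c k}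

omit [TopologicalSpace X] [PolishSpace X] [MeasurableSpace X] [BorelSpace X] in
theorem locallyBoundedEnergy_of_mem {fε : ℝ → G × X → ℝ≥0∞} {c : ℕ → ℝ≥0∞}
    (hc : ∀ k, c k ≠ ∞) {ε : ℕ → ℝ} {z : ℕ → G × X}
    (hz : ∀ n, z n ∈ lowEnergySet θ fε c (ε n)) : LocallyBoundedEnergy θ fε ε z := by
  intro R _
  obtain ⟨k, hk⟩ := exists_nat_ge R
  refine lt_of_le_of_lt ?_ (hc k).lt_top
  refine limsup_le_of_le (by isBoundedDefault) (Eventually.of_forall fun n => ?_)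
  exact (lintegral_mono_set (Metric.ball_subset_ball (by linarith))).trans (hz n k)

/-- Markov's inequality for each integer radius, with failure probabilities `e k` of total at most
`δ`. The thresholds depend on `C` and `δ` only, not on `ε` or `u`, so they bound the energies along
whole sequences. -/
theorem exists_lowEnergySet (hG : IsMacroDomain G) (hθ : IsContAction θ)
    {fε : ℝ → G × X → ℝ≥0∞} (hfε : ∀ ε, 0 < ε → Measurable (fε ε)) (C : ℝ≥0) {δ : ℝ≥0}
    (hδ : 0 < δ) :
    ∃ c : ℕ → ℝ≥0∞, (∀ k, c k ≠ ∞) ∧ ∀ ε u, 0 < ε → macroEnergy θ fε ε u ≤ C →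
      (blowupMeasure hG hθ ε u : Measure (G × X)) (lowEnergySet θ fε c ε)ᶜ ≤ δ := by
  obtain ⟨e, he, hesum⟩ := ENNReal.exists_pos_sum_of_countable (ε := (δ : ℝ≥0∞))
    (by exact_mod_cast hδ.ne') ℕ
  let v : ℕ → ℝ≥0∞ := fun k => volume (Metric.ball (0 : EuclideanSpace ℝ (Fin d)) (k + 1))
  have hv0 : ∀ k, v k ≠ 0 := fun k => (Metric.measure_ball_pos _ _ (by positivity)).ne'
  have hvt : ∀ k, v k ≠ ∞ := fun k => measure_ball_lt_top.ne
  have he0 : ∀ k, (e k : ℝ≥0∞) ≠ 0 := fun k => by exact_mod_cast (he k).ne'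
  -- `C + 1` rather than `C`, since Markov's inequality divides by the threshold.
  let c : ℕ → ℝ≥0∞ := fun k => v k * ((C + 1) / e k)
  have hct : ∀ k, c k ≠ ∞ := fun k => ENNReal.mul_ne_top (hvt k)
    (ENNReal.div_ne_top (by finiteness) (he0 k))
  have hc0 : ∀ k, c k ≠ 0 := fun k => mul_ne_zero (hv0 k)
    (ENNReal.div_ne_zero.2 ⟨by simp, ENNReal.coe_ne_top⟩)
  refine ⟨c, hct, fun ε u hε hu => ?_⟩
  have hsub : (lowEnergySet θ fε c ε)ᶜ ⊆ ⋃ k : ℕ, {z | c k ≤ localEnergy θ fε ε (k + 1) z} := by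
    intro z hz
    simp only [lowEnergySet, mem_compl_iff, mem_ofPred_eq, not_forall, not_le] at hz
    obtain ⟨k, hk⟩ := hz
    exact mem_iUnion.2 ⟨k, hk.le⟩
  refine (measure_mono hsub).trans ((measure_iUnion_le _).trans ?_)
  refine le_trans (ENNReal.tsum_le_tsum fun k => ?_) hesum.le
  refine (meas_ge_le_lintegral_div (measurable_localEnergy hG.isCompact.measurableSet hθ
    (hfε ε hε) _).aemeasurable (hc0 k) (hct k)).trans ?_
  refine ENNReal.div_le_of_le_mul ?_
  refine (lintegral_localEnergy_le hG hθ hε (hfε ε hε) _ u).trans ?_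
  calc v k * macroEnergy θ fε ε u ≤ v k * (C + 1) := by gcongr; exact hu.trans le_self_add
    _ = e k * c k := by
      simp only [c]
      rw [mul_left_comm, ENNReal.mul_div_cancel (he0 k) ENNReal.coe_ne_top]

end Energy

/-! ### Tightness of blow-up measures and of their laws -/

section Compactness

variable {d : ℕ} {X : Type*} [TopologicalSpace X] [PolishSpace X] [MeasurableSpace X]
  [BorelSpace X] {θ : EuclideanSpace ℝ (Fin d) → X → X} {G : Set (EuclideanSpace ℝ (Fin d))}

theorem blowupMeasure_compl_range (hG : IsMacroDomain G) (hθ : IsContAction θ) (ε : ℝ) (u : X) :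
    (blowupMeasure hG hθ ε u : Measure (G × X))
      (range fun x : G => (x, θ (ε⁻¹ • (x : EuclideanSpace ℝ (Fin d))) u))ᶜ = 0 := by
  have : CompactSpace G := isCompact_iff_compactSpace.1 hG.isCompact
  have hr := (isCompact_range (continuous_blowup (G := G) hθ ε u)).measurableSet
  change (Measure.map _ _) _ = 0
  rw [Measure.map_apply (continuous_blowup hθ ε u).measurable hr.compl]
  convert measure_empty
  · ext x; simp
  · infer_instance

/-- Coercivity handles sequences drawn from low-energy sets of increasing index. Intersecting with
the compact image of `G`, which carries the whole measure, handles those that remain at one index.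
-/
theorem isTightMeasureSet_blowupMeasure (hG : IsMacroDomain G) (hθ : IsContAction θ)
    {fε : ℝ → G × X → ℝ≥0∞} (hfε : ∀ ε, 0 < ε → Measurable (fε ε))
    (hcoer : IsEnergyCoercive θ fε) {ε : ℕ → ℝ} (hεpos : ∀ n, 0 < ε n)
    (hε : Tendsto ε atTop (𝓝 0)) {u : ℕ → X} {C : ℝ≥0}
    (hu : ∀ n, macroEnergy θ fε (ε n) (u n) ≤ C) :
    IsTightMeasureSet (range fun n => (blowupMeasure hG hθ (ε n) (u n) : Measure (G × X))) := by
  have : CompactSpace G := isCompact_iff_compactSpace.1 hG.isCompact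
  rw [isTightMeasureSet_iff_exists_isCompact_measure_compl_le]
  intro δ hδ
  obtain ⟨δ', hδ'0, hδ'⟩ := ENNReal.lt_iff_exists_nnreal_btwn.1 hδ
  obtain ⟨c, hc, hcδ⟩ := exists_lowEnergySet hG hθ hfε C (δ := δ') (by exact_mod_cast hδ'0)
  let r : ℕ → Set (G × X) := fun n =>
    range fun x : G => (x, θ ((ε n)⁻¹ • (x : EuclideanSpace ℝ (Fin d))) (u n))
  let S : ℕ → Set (G × X) := fun n => lowEnergySet θ fε c (ε n) ∩ r n
  have hS : IsCompact (closure (⋃ n, S n)) := by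
    refine isCompact_closure_iUnion_of_seq
      (fun n => ⟨r n, isCompact_range (continuous_blowup hθ _ _), inter_subset_right⟩)
      fun φ z hφ hz => ?_
    exact hcoer (ε ∘ φ) z (fun n => hεpos _) (hε.comp hφ.tendsto_atTop)
      (locallyBoundedEnergy_of_mem hc fun n => (hz n).1)
  refine ⟨_, hS, ?_⟩
  rintro _ ⟨n, rfl⟩
  calc (blowupMeasure hG hθ (ε n) (u n) : Measure (G × X)) (closure (⋃ n, S n))ᶜ
      ≤ (blowupMeasure hG hθ (ε n) (u n) : Measure (G × X)) (S n)ᶜ :=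
        measure_mono (compl_subset_compl.2 ((subset_iUnion S n).trans subset_closure))
    _ ≤ (blowupMeasure hG hθ (ε n) (u n) : Measure (G × X)) (lowEnergySet θ fε c (ε n))ᶜ +
        (blowupMeasure hG hθ (ε n) (u n) : Measure (G × X)) (r n)ᶜ := by
        rw [compl_inter]; exact measure_union_le _ _
    _ ≤ δ := by
        rw [blowupMeasure_compl_range, add_zero]
        exact (hcδ _ _ (hεpos n) (hu n)).trans hδ'.le

theorem exists_subseq_tendsto_blowupMeasure (hG : IsMacroDomain G) (hθ : IsContAction θ)
    {fε : ℝ → G × X → ℝ≥0∞} (hfε : ∀ ε, 0 < ε → Measurable (fε ε))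
    (hcoer : IsEnergyCoercive θ fε) {ε : ℕ → ℝ} (hεpos : ∀ n, 0 < ε n)
    (hε : Tendsto ε atTop (𝓝 0)) {u : ℕ → X} {C : ℝ≥0}
    (hu : ∀ n, macroEnergy θ fε (ε n) (u n) ≤ C) :
    ∃ (φ : ℕ → ℕ) (P : ProbabilityMeasure (G × X)), StrictMono φ ∧
      Tendsto (fun k => blowupMeasure hG hθ (ε (φ k)) (u (φ k))) atTop (𝓝 P) := by
  have hcomp := isCompact_closure_of_isTightMeasureSet
    (S := range fun n => blowupMeasure hG hθ (ε n) (u n)) (by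
      convert isTightMeasureSet_blowupMeasure hG hθ hfε hcoer hεpos hε hu using 1
      ext μ
      simp [mem_range])
  obtain ⟨P, -, φ, hφ, hP⟩ := hcomp.tendsto_subseq
    (x := fun n => blowupMeasure hG hθ (ε n) (u n)) fun n => subset_closure (mem_range_self n)
  exact ⟨φ, P, hφ, hP⟩

instance ProbSpace.instMetrizableSpace (Z : Type*) [TopologicalSpace Z]
    [TopologicalSpace.PseudoMetrizableSpace Z] [SecondCountableTopology Z] [MeasurableSpace Z]
    [BorelSpace Z] : TopologicalSpace.MetrizableSpace (ProbSpace Z) :=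
  inferInstanceAs (TopologicalSpace.MetrizableSpace (ProbabilityMeasure Z))

/-- Lets Prokhorov's theorem be applied a second time, to laws on `ProbSpace Z`. -/
instance ProbSpace.instSecondCountableTopology (Z : Type*) [TopologicalSpace Z]
    [TopologicalSpace.PseudoMetrizableSpace Z] [SecondCountableTopology Z] [MeasurableSpace Z]
    [BorelSpace Z] : SecondCountableTopology (ProbSpace Z) :=
  secondCountableTopology_probabilityMeasure Z

theorem isTightMeasureSet_blowupLaw (hG : IsMacroDomain G) (hθ : IsContAction θ)
    {fε : ℝ → G × X → ℝ≥0∞} (hfε : ∀ ε, 0 < ε → Measurable (fε ε))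
    (hcoer : IsEnergyCoercive θ fε) {ε : ℕ → ℝ} (hεpos : ∀ n, 0 < ε n)
    (hε : Tendsto ε atTop (𝓝 0)) {ℙ : ℕ → ProbabilityMeasure X}
    (hℙ : Tendsto (fun M : ℝ≥0 =>
      limsup (fun n => (ℙ n : Measure X) {v | (M : ℝ≥0∞) ≤ macroEnergy θ fε (ε n) v}) atTop)
      atTop (𝓝 0)) :
    IsTightMeasureSet
      (range fun n => (blowupLaw hG hθ (ε n) (ℙ n) : Measure (ProbSpace (G × X)))) := by
  rw [isTightMeasureSet_iff_exists_isCompact_measure_compl_le]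
  intro δ hδ
  have hδ2 : 0 < δ / 2 := ENNReal.half_pos hδ.ne'
  obtain ⟨M, hM⟩ := (hℙ.eventually_lt_const hδ2).exists
  obtain ⟨N, hN⟩ := eventually_atTop.1 (eventually_lt_of_limsup_lt hM)
  have hL : ∀ n, ∃ L : Set X, IsCompact L ∧ (ℙ n : Measure X) Lᶜ ≤ δ / 2 := fun n => by
    obtain ⟨L, hL, hL'⟩ := isTightMeasureSet_iff_exists_isCompact_measure_compl_le.1
      (isTightMeasureSet_singleton (μ := (ℙ n : Measure X))) _ hδ2
    exact ⟨L, hL, hL' _ rfl⟩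
  choose L hLc hL using hL
  -- The hypothesis controls the energy only for large `n`; for the finitely many others the compact
  -- set `L n` is enough.
  let A : ℕ → Set X := fun n => L n ∩ {v | N ≤ n → macroEnergy θ fε (ε n) v ≤ M}
  let S : ℕ → Set (ProbSpace (G × X)) := fun n => blowupMap hG hθ (ε n) '' A n
  have hS : IsCompact (closure (⋃ n, S n)) := by
    refine isCompact_closure_iUnion_of_seq (fun n => ⟨blowupMap hG hθ (ε n) '' L n,
      (hLc n).image (continuous_blowupMap hG hθ _), image_mono inter_subset_left⟩)
      fun φ z hφ hz => ?_
    choose u hu huz using hz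
    -- Dropping `N` terms gives `φ (k + N) ≥ N`, where the energy bound is in force.
    obtain ⟨ψ, P, hψ, hP⟩ := exists_subseq_tendsto_blowupMeasure hG hθ hfε hcoer
      (ε := fun k => ε (φ (k + N))) (u := fun k => u (k + N)) (C := M) (fun _ => hεpos _)
      (hε.comp (hφ.tendsto_atTop.comp (tendsto_add_atTop_nat N)))
      (fun k => (hu (k + N)).2 ((Nat.le_add_left _ _).trans (hφ.id_le _)))
    refine ⟨fun k => ψ k + N, P, fun a b hab => by simpa using hψ hab, ?_⟩
    refine Tendsto.congr (fun k => ?_) hP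
    exact huz _
  refine ⟨_, hS, ?_⟩
  rintro _ ⟨n, rfl⟩
  have hmap : (blowupLaw hG hθ (ε n) (ℙ n) : Measure (ProbSpace (G × X))) (closure (⋃ n, S n))ᶜ =
      (ℙ n : Measure X) (blowupMap hG hθ (ε n) ⁻¹' (closure (⋃ n, S n))ᶜ) :=
    Measure.map_apply (continuous_blowupMap hG hθ _).measurable isClosed_closure.measurableSet.compl
  rw [hmap]
  have hsub : blowupMap hG hθ (ε n) ⁻¹' (closure (⋃ n, S n))ᶜ ⊆
      (L n)ᶜ ∪ {v | N ≤ n ∧ (M : ℝ≥0∞) ≤ macroEnergy θ fε (ε n) v} := by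
    intro v hv
    by_contra hno
    simp only [mem_union, mem_compl_iff, not_or, not_not, mem_ofPred_eq, not_and, not_le] at hno
    exact hv (subset_closure (mem_iUnion.2 ⟨n, v, ⟨hno.1, fun h => (hno.2 h).le⟩, rfl⟩))
  refine (measure_mono hsub).trans ((measure_union_le _ _).trans ?_)
  rw [← ENNReal.add_halves δ]
  refine add_le_add (hL n) ?_
  by_cases hn : N ≤ n
  · simpa [hn] using (hN n hn).le
  · simp [hn]

theorem exists_subseq_tendsto_of_isTightMeasureSet {Y : Type*} [TopologicalSpace Y]
    [TopologicalSpace.MetrizableSpace Y] [SecondCountableTopology Y] [MeasurableSpace Y]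
    [BorelSpace Y] {Q : ℕ → ProbabilityMeasure Y}
    (hQ : IsTightMeasureSet (range fun n => (Q n : Measure Y))) :
    ∃ (φ : ℕ → ℕ) (R : ProbabilityMeasure Y), StrictMono φ ∧
      Tendsto (fun k => Q (φ k)) atTop (𝓝 R) := by
  have hcomp := isCompact_closure_of_isTightMeasureSet (S := range Q) (by
      convert hQ using 1
      ext μ
      simp [mem_range])
  obtain ⟨R, -, φ, hφ, hR⟩ := hcomp.tendsto_subseq (x := Q)
    fun n => subset_closure (mem_range_self n)
  exact ⟨φ, R, hφ, hR⟩

end Compactness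

/-! ### The first marginal, and from constant to variable shifts -/

section Invariance

variable {d : ℕ} {X : Type*} [TopologicalSpace X] [PolishSpace X] [MeasurableSpace X]
  [BorelSpace X] {θ : EuclideanSpace ℝ (Fin d) → X → X} {G : Set (EuclideanSpace ℝ (Fin d))}

theorem map_fst_blowupMeasure (hG : IsMacroDomain G) (hθ : IsContAction θ) (ε : ℝ) (u : X) :
    (blowupMeasure hG hθ ε u).map (f := Prod.fst) measurable_fst.aemeasurable =
      normLebesgue hG := by
  apply Subtype.ext
  change Measure.map Prod.fst (Measure.map _ _) = _
  rw [Measure.map_map measurable_fst (continuous_blowup hθ ε u).measurable]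
  exact Measure.map_id

theorem map_fst_eq_normLebesgue (hG : IsMacroDomain G) (hθ : IsContAction θ) {ε : ℕ → ℝ}
    {u : ℕ → X} {P : ProbabilityMeasure (G × X)}
    (hP : Tendsto (fun k => blowupMeasure hG hθ (ε k) (u k)) atTop (𝓝 P)) :
    (P : Measure (G × X)).map Prod.fst = (normLebesgue hG : Measure G) := by
  have h1 := ProbabilityMeasure.tendsto_map_of_tendsto_of_continuous _ _ hP
    (continuous_fst : Continuous (Prod.fst : G × X → G))
  have h2 : P.map (f := Prod.fst) measurable_fst.aemeasurable = normLebesgue hG := by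
    refine tendsto_nhds_unique h1 ?_
    simp only [map_fst_blowupMeasure hG hθ]
    exact tendsto_const_nhds
  exact congrArg Subtype.val h2

/-- Invariance under all constant shifts of the second variable implies invariance under
shifts depending measurably on the first variable. -/
theorem map_shift_eq_of_forall_const {Y : Type*} [MeasurableSpace Y] [TopologicalSpace Y]
    [TopologicalSpace.PseudoMetrizableSpace Y] [SecondCountableTopology Y] [BorelSpace Y]
    (hθ : IsContAction θ) {P : Measure (Y × X)} [IsProbabilityMeasure P]
    (hP : ∀ a, P.map (fun p : Y × X => (p.1, θ a p.2)) = P)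
    {lam : Y → EuclideanSpace ℝ (Fin d)} (hlam : Measurable lam) :
    P.map (fun p : Y × X => (p.1, θ (lam p.1) p.2)) = P := by
  have hmeas : ∀ {l : Y → EuclideanSpace ℝ (Fin d)}, Measurable l →
      Measurable fun p : Y × X => (p.1, θ (l p.1) p.2) := fun hl =>
    measurable_fst.prodMk (hθ.measurable_uncurry.comp
      ((hl.comp measurable_fst).prodMk measurable_snd))
  -- The shift fixes the first coordinate, so it preserves each fibre of `s`, and on a fibre it is a
  -- constant shift.
  have hsimple : ∀ s : SimpleFunc Y (EuclideanSpace ℝ (Fin d)),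
      P.map (fun p : Y × X => (p.1, θ (s p.1) p.2)) = P := by
    intro s
    ext B hB
    have hfib : ∀ c, MeasurableSet ((fun p : Y × X => s p.1) ⁻¹' {c}) := fun c =>
      (s.measurable.comp measurable_fst) (measurableSet_singleton c)
    have hdecomp : ∀ D : Set (Y × X), P D =
        ∑ c ∈ s.range, P ((fun p : Y × X => s p.1) ⁻¹' {c} ∩ D) := by
      intro D
      have := sum_measure_preimage_singleton (μ := P.restrict D) s.range
        (f := fun p : Y × X => s p.1) fun c _ => hfib c
      simp only [Measure.restrict_apply (hfib _)] at this
      rw [this]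
      have huniv : (fun p : Y × X => s p.1) ⁻¹' (s.range : Set _) = univ := by
        ext p; simp
      rw [huniv, Measure.restrict_apply_univ]
    rw [Measure.map_apply (hmeas s.measurable) hB, hdecomp, hdecomp B]
    refine Finset.sum_congr rfl fun c _ => ?_
    conv_rhs => rw [← hP c, Measure.map_apply (hmeas measurable_const) ((hfib c).inter hB)]
    congr 1
    ext p
    simp only [mem_inter_iff, mem_preimage, mem_singleton_iff]
    refine and_congr_right fun hp => ?_
    rw [hp]
  have hsm : StronglyMeasurable lam := hlam.stronglyMeasurable
  have : IsProbabilityMeasure (P.map (fun p : Y × X => (p.1, θ (lam p.1) p.2))) :=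
    Measure.isProbabilityMeasure_map (hmeas hlam).aemeasurable
  refine ext_of_forall_integral_eq_of_IsFiniteMeasure fun h => ?_
  rw [integral_map (hmeas hlam).aemeasurable h.continuous.aestronglyMeasurable]
  have hlim : Tendsto (fun n => ∫ p : Y × X, h (p.1, θ (hsm.approx n p.1) p.2) ∂P) atTop
      (𝓝 (∫ p : Y × X, h (p.1, θ (lam p.1) p.2) ∂P)) := by
    refine tendsto_integral_of_dominated_convergence (fun _ => ‖h‖)
      (fun n => (h.continuous.measurable.comp (hmeas (hsm.approx n).measurable)).aestronglyMeasurable)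
      (integrable_const _) (fun n => Eventually.of_forall fun p => h.norm_coe_le_norm _)
      (Eventually.of_forall fun p => ?_)
    exact ((h.continuous.comp (continuous_const.prodMk (hθ.continuous_param p.2))).tendsto _).comp
      (hsm.tendsto_approx p.1)
  refine tendsto_nhds_unique hlim (tendsto_const_nhds.congr fun n => ?_)
  conv_lhs => rw [← hsimple (hsm.approx n)]
  rw [integral_map (hmeas (hsm.approx n).measurable).aemeasurable
    h.continuous.aestronglyMeasurable]

end Invariance

/-! ### Invariance of the limits and the lower bound -/

section ConstantShift

variable {d : ℕ} {X : Type*} [TopologicalSpace X] [PolishSpace X] [MeasurableSpace X]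
  [BorelSpace X] {θ : EuclideanSpace ℝ (Fin d) → X → X} {G : Set (EuclideanSpace ℝ (Fin d))}

/-- Comparison of the integrals of a bounded function which is Lipschitz in the macroscopic
variable, against a blow-up measure and its image by a shift. -/
theorem abs_integral_shift_sub_le (hG : IsMacroDomain G) (hθ : IsContAction θ) {ε : ℝ}
    (hε : 0 < ε) (u : X) (a : EuclideanSpace ℝ (Fin d)) {h : G × X → ℝ} (hh : Continuous h)
    {M L : ℝ} (hM0 : 0 ≤ M) (hL0 : 0 ≤ L) (hM : ∀ p, |h p| ≤ M)
    (hL : ∀ x y v, |h (x, v) - h (y, v)| ≤ L * dist x y) :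
    |∫ p, h (p.1, θ a p.2) ∂(blowupMeasure hG hθ ε u : Measure (G × X)) -
        ∫ p, h p ∂(blowupMeasure hG hθ ε u : Measure (G × X))| ≤
      L * (ε * ‖a‖) +
        M * (volume (((fun y => y + ε • (-a)) '' G) ∆ G) / volume G).toReal := by
  classical
  have hGm := hG.isCompact.measurableSet
  have hGt : volume G ≠ ∞ := hG.isCompact.measure_lt_top.ne
  have hG0 : 0 < volume.real G := ENNReal.toReal_pos hG.volume_pos.ne' hGt
  let B : Set (EuclideanSpace ℝ (Fin d)) := (fun y => y + ε • (-a)) '' G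
  have hBmem : ∀ x, x ∈ B ↔ x + ε • a ∈ G := fun x => by
    constructor
    · rintro ⟨y, hy, rfl⟩
      simpa using hy
    · exact fun hx => ⟨_, hx, by simp⟩
  have hBc : IsCompact B := hG.isCompact.image (by fun_prop)
  have hBt : volume B ≠ ∞ := hBc.measure_lt_top.ne
  have hDm : MeasurableSet (B ∆ G) := hBc.measurableSet.symmDiff hGm
  have hDt : volume (B ∆ G) ≠ ∞ := ne_top_of_le_ne_top (by finiteness)
    ((measure_mono (symmDiff_subset_union (s := B) (t := G))).trans (measure_union_le _ _))
  -- `Φ x` and `Ψ (x + ε • a)` share the microscopic argument and differ only in the macroscopic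
  -- one, by `ε • a`. The Lipschitz bound applies where both points lie in `G`; the bound `M` pays
  -- for `B ∆ G`, where exactly one does.
  let Φ : EuclideanSpace ℝ (Fin d) → ℝ := fun x =>
    if hx : x ∈ G then h (⟨x, hx⟩, θ (ε⁻¹ • (x + ε • a)) u) else 0
  let Ψ : EuclideanSpace ℝ (Fin d) → ℝ := fun x =>
    if hx : x ∈ G then h (⟨x, hx⟩, θ (ε⁻¹ • x) u) else 0
  have hθc : Continuous fun x : EuclideanSpace ℝ (Fin d) => θ x u := hθ.continuous_param u
  have hΦm : Measurable Φ := Measurable.dite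
    (f := fun x : G => h (x, θ (ε⁻¹ • ((x : EuclideanSpace ℝ (Fin d)) + ε • a)) u))
    (hh.comp (continuous_id.prodMk (hθc.comp (by fun_prop)))).measurable
    (g := fun _ => 0) measurable_const hGm
  have hΨm : Measurable Ψ := Measurable.dite
    (f := fun x : G => h (x, θ (ε⁻¹ • (x : EuclideanSpace ℝ (Fin d))) u))
    (hh.comp (continuous_id.prodMk (hθc.comp (by fun_prop)))).measurable
    (g := fun _ => 0) measurable_const hGm
  have hbdd : ∀ F : EuclideanSpace ℝ (Fin d) → ℝ, Measurable F → (∀ x ∉ G, F x = 0) →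
      (∀ x, |F x| ≤ M) → Integrable F := fun F hF h0 hb => by
    rw [← integrableOn_iff_integrable_of_support_subset (s := G)]
    · exact Measure.integrableOn_of_bounded (M := M) hGt hF.aestronglyMeasurable
        (Eventually.of_forall hb)
    · intro x hx
      by_contra hxG
      exact hx (h0 x hxG)
  have hΦ0 : ∀ x ∉ G, Φ x = 0 := fun x hx => dif_neg hx
  have hΨ0 : ∀ x ∉ G, Ψ x = 0 := fun x hx => dif_neg hx
  have hΦM : ∀ x, |Φ x| ≤ M := fun x => by
    simp only [Φ]; split_ifs; exacts [hM _, by simpa using hM0]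
  have hΨM : ∀ x, |Ψ x| ≤ M := fun x => by
    simp only [Ψ]; split_ifs; exacts [hM _, by simpa using hM0]
  have hΦi := hbdd Φ hΦm hΦ0 hΦM
  have hΨi := hbdd Ψ hΨm hΨ0 hΨM
  have hpt : ∀ x, |Φ x - Ψ (x + ε • a)| ≤
      G.indicator (fun _ => L * (ε * ‖a‖)) x + (B ∆ G).indicator (fun _ => M) x := by
    intro x
    by_cases hx : x ∈ G <;> by_cases hxa : x + ε • a ∈ G
    · have hD : x ∉ B ∆ G := by simp [mem_symmDiff, hBmem, hx, hxa]
      rw [indicator_of_mem hx, indicator_of_notMem hD, add_zero]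
      simp only [Φ, Ψ, hx, hxa, dif_pos]
      refine (hL _ _ _).trans (le_of_eq ?_)
      rw [Subtype.dist_eq, dist_self_add_right, norm_smul, Real.norm_of_nonneg hε.le]
    · have hD : x ∈ B ∆ G := by simp [mem_symmDiff, hBmem, hx, hxa]
      rw [indicator_of_mem hx, indicator_of_mem hD, hΨ0 _ hxa, sub_zero]
      have : 0 ≤ L * (ε * ‖a‖) := by positivity
      linarith [hΦM x]
    · have hD : x ∈ B ∆ G := by simp [mem_symmDiff, hBmem, hx, hxa]
      rw [indicator_of_notMem hx, indicator_of_mem hD, hΦ0 _ hx, zero_sub, abs_neg, zero_add]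
      exact hΨM _
    · have hD : x ∉ B ∆ G := by simp [mem_symmDiff, hBmem, hx, hxa]
      rw [indicator_of_notMem hx, indicator_of_notMem hD, hΦ0 _ hx, hΨ0 _ hxa]
      simp
  have hI1 : ∫ p, h (p.1, θ a p.2) ∂(blowupMeasure hG hθ ε u : Measure (G × X)) =
      (volume.real G)⁻¹ * ∫ x, Φ x := by
    rw [← integral_normLebesgue hG Φ hΦ0]
    refine (integral_map (continuous_blowup hθ ε u).measurable.aemeasurable
      (hh.comp (continuous_fst.prodMk ((hθ.continuous_space a).comp
        continuous_snd))).aestronglyMeasurable).trans (integral_congr_ae ?_)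
    refine Eventually.of_forall fun x => ?_
    simp only [Φ, x.2, dif_pos, Function.comp_apply, hθ.map_add, smul_add,
      inv_smul_smul₀ hε.ne', add_comm a]
  have hI2 : ∫ p, h p ∂(blowupMeasure hG hθ ε u : Measure (G × X)) =
      (volume.real G)⁻¹ * ∫ x, Ψ x := by
    rw [← integral_normLebesgue hG Ψ hΨ0]
    refine (integral_map (continuous_blowup hθ ε u).measurable.aemeasurable
      hh.aestronglyMeasurable).trans (integral_congr_ae ?_)
    refine Eventually.of_forall fun x => ?_
    simp only [Ψ, x.2, dif_pos]
  have hmain : |(∫ x, Φ x) - ∫ x, Ψ x| ≤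
      volume.real G * (L * (ε * ‖a‖)) + volume.real (B ∆ G) * M := by
    rw [← integral_add_right_eq_self Ψ (ε • a),
      ← integral_sub hΦi (hΨi.comp_add_right (ε • a))]
    have hi1 : Integrable (G.indicator fun _ => L * (ε * ‖a‖)) (volume : Measure (EuclideanSpace ℝ (Fin d))) :=
      (integrable_indicator_iff hGm).2 (integrableOn_const hGt)
    have hi2 : Integrable ((B ∆ G).indicator fun _ => M) (volume : Measure (EuclideanSpace ℝ (Fin d))) :=
      (integrable_indicator_iff hDm).2 (integrableOn_const hDt)
    refine (norm_integral_le_of_norm_le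
      (f := fun x => Φ x - Ψ (x + ε • a)) (hi1.add hi2) (Eventually.of_forall fun x => hpt x)).trans ?_
    simp only [Pi.add_apply]
    rw [integral_add hi1 hi2, integral_indicator hGm, integral_indicator hDm, setIntegral_const,
      setIntegral_const, smul_eq_mul, smul_eq_mul]
  rw [hI1, hI2, ← mul_sub, abs_mul, abs_of_pos (inv_pos.2 hG0), inv_mul_le_iff₀ hG0,
    ENNReal.toReal_div]
  refine hmain.trans (le_of_eq ?_)
  change _ = volume.real G * (L * (ε * ‖a‖) + M * (volume.real (B ∆ G) / volume.real G))
  field_simp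

theorem map_const_shift_eq (hG : IsMacroDomain G) (hθ : IsContAction θ) {ε : ℕ → ℝ}
    (hεpos : ∀ n, 0 < ε n) (hε : Tendsto ε atTop (𝓝 0)) {u : ℕ → X}
    {P : ProbabilityMeasure (G × X)}
    (hP : Tendsto (fun k => blowupMeasure hG hθ (ε k) (u k)) atTop (𝓝 P))
    (a : EuclideanSpace ℝ (Fin d)) :
    (P : Measure (G × X)).map (fun p : G × X => (p.1, θ a p.2)) = P := by
  let := TopologicalSpace.upgradeIsCompletelyMetrizable X
  have hc : Continuous fun p : G × X => (p.1, θ a p.2) :=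
    continuous_fst.prodMk ((hθ.continuous_space a).comp continuous_snd)
  have h1 := ProbabilityMeasure.tendsto_map_of_tendsto_of_continuous _ _ hP hc
  refine congrArg Subtype.val (tendsto_nhds_unique h1 (b := P) ?_)
  rw [tendsto_iff_forall_lipschitz_integral_tendsto] at hP ⊢
  rintro h ⟨C, hC⟩ ⟨L, hL⟩
  have hlim := hP h ⟨C, hC⟩ ⟨L, hL⟩
  obtain ⟨p₀⟩ := P.nonempty
  -- Boundedness is given as a bound `C` on the oscillation; a base point turns it into a uniform
  -- bound.
  have hM : ∀ p, |h p| ≤ C + |h p₀| := fun p => by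
    have := hC p p₀
    rw [Real.dist_eq] at this
    have := abs_sub_abs_le_abs_sub (h p) (h p₀)
    linarith
  have hεw : Tendsto ε atTop (𝓝[>] 0) :=
    tendsto_nhdsWithin_iff.2 ⟨hε, Eventually.of_forall hεpos⟩
  have hshift := (ENNReal.tendsto_toReal ENNReal.zero_ne_top).comp ((hG.shift (-a)).comp hεw)
  have hzero : Tendsto (fun k => L * (ε k * ‖a‖) + (C + |h p₀|) *
      (volume (((fun y => y + ε k • (-a)) '' G) ∆ G) / volume G).toReal) atTop (𝓝 0) := by
    have := ((hε.mul_const ‖a‖).const_mul (L : ℝ)).add (hshift.const_mul (C + |h p₀|))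
    simpa using this
  have hdiff := squeeze_zero_norm (f := fun k =>
    ∫ p, h (p.1, θ a p.2) ∂(blowupMeasure hG hθ (ε k) (u k) : Measure (G × X)) -
      ∫ p, h p ∂(blowupMeasure hG hθ (ε k) (u k) : Measure (G × X)))
    (fun k => abs_integral_shift_sub_le hG hθ (hεpos k) (u k) a
    hL.continuous ((abs_nonneg _).trans (hM p₀)) L.2 hM (L := L) fun x y v => ?_) hzero
  · refine (hdiff.add hlim).congr' ?_ |>.trans (by simp)
    refine Eventually.of_forall fun k => ?_
    simp only [sub_add_cancel]
    exact (integral_map hc.measurable.aemeasurable hL.continuous.aestronglyMeasurable).symm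
  · have := hL.dist_le_mul (x, v) (y, v)
    rwa [Real.dist_eq, Prod.dist_eq, dist_self, max_eq_left dist_nonneg] at this

theorem isTLambdaInvariant_of_tendsto (hG : IsMacroDomain G) (hθ : IsContAction θ) {ε : ℕ → ℝ}
    (hεpos : ∀ n, 0 < ε n) (hε : Tendsto ε atTop (𝓝 0)) {u : ℕ → X}
    {P : ProbabilityMeasure (G × X)}
    (hP : Tendsto (fun k => blowupMeasure hG hθ (ε k) (u k)) atTop (𝓝 P)) :
    IsTLambdaInvariant θ (P : Measure (G × X)) := fun lam hlam =>
  map_shift_eq_of_forall_const hθ (map_const_shift_eq hG hθ hεpos hε hP)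
    (lam := fun x : G => lam x) (hlam.continuous.measurable.comp measurable_subtype_coe)

theorem isPreservingAction_of_invariant (hθ : IsContAction θ) {P : Measure (G × X)}
    (hP : ∀ a, P.map (fun p : G × X => (p.1, θ a p.2)) = P) :
    IsPreservingAction (fun a (p : G × X) => (p.1, θ a p.2)) P where
  measurable := (measurable_fst.comp measurable_snd).prodMk (hθ.measurable_uncurry.comp
    (measurable_fst.prodMk (measurable_snd.comp measurable_snd)))
  map_zero p := by simp [hθ.map_zero]
  map_add a b p := by simp [hθ.map_add]
  preserving a := ⟨measurable_fst.prodMk ((hθ.continuous_space a).measurable.comp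
    measurable_snd), hP a⟩

/-- The low-energy sets are the sets of almost full measure on which the abstract lower bound
requires the Γ-liminf inequality. -/
theorem lintegral_le_liminf_macroEnergy (hG : IsMacroDomain G) (hθ : IsContAction θ)
    {fε : ℝ → G × X → ℝ≥0∞} {f : G × X → ℝ≥0∞} (hfε : ∀ ε, 0 < ε → Measurable (fε ε))
    (hf : Measurable f) (hliminf : IsGammaLiminf θ fε f) {ε : ℕ → ℝ} (hεpos : ∀ n, 0 < ε n)
    (hε : Tendsto ε atTop (𝓝 0)) {u : ℕ → X} {C : ℝ≥0}
    (hu : ∀ n, macroEnergy θ fε (ε n) (u n) ≤ C) {P : ProbabilityMeasure (G × X)}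
    (hP : Tendsto (fun k => blowupMeasure hG hθ (ε k) (u k)) atTop (𝓝 P)) :
    ∫⁻ p, f p ∂(P : Measure (G × X)) ≤
      liminf (fun k => macroEnergy θ fε (ε k) (u k)) atTop := by
  simp only [fun k => macroEnergy_eq_lintegral hG hθ (hfε _ (hεpos k)) (u k)]
  refine lintegral_le_liminf_of_gammaLiminf hP (h := fun k => fε (ε k))
    (fun k => hfε _ (hεpos k)) hf fun δ hδ => ?_
  obtain ⟨c, hc, hcδ⟩ := exists_lowEnergySet hG hθ hfε C hδ
  exact ⟨fun k => lowEnergySet θ fε c (ε k), fun k => hcδ _ _ (hεpos k) (hu k),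
    fun φ z w hφ hz hw => hliminf (ε ∘ φ) z w (fun _ => hεpos _) (hε.comp hφ.tendsto_atTop)
      (locallyBoundedEnergy_of_mem hc hz) hw⟩

end ConstantShift

/-! ### The main theorem -/

theorem theorem6 {d : ℕ} {X : Type*} [TopologicalSpace X] [PolishSpace X]
    [MeasurableSpace X] [BorelSpace X]
    (θ : EuclideanSpace ℝ (Fin d) → X → X) (hθ : IsContAction θ)
    (G : Set (EuclideanSpace ℝ (Fin d))) (hG : IsMacroDomain G)
    (fε : ℝ → G × X → ℝ≥0∞) (f : G × X → ℝ≥0∞)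
    (hfε : ∀ ε, 0 < ε → Measurable (fε ε)) (hf : Measurable f)
    (hcoer : IsEnergyCoercive θ fε) (hliminf : IsGammaLiminf θ fε f)
    (U : ℝ → Set (EuclideanSpace ℝ (Fin d))) (hU : IsVitaliFolner U)
    (ε : ℕ → ℝ) (hεpos : ∀ n, 0 < ε n) (hε : Tendsto ε atTop (𝓝 0)) :
    -- Part A
    (∀ u : ℕ → X, (∃ C : ℝ≥0, ∀ n, macroEnergy θ fε (ε n) (u n) ≤ C) →
      (∃ (φ : ℕ → ℕ) (P : ProbabilityMeasure (G × X)), StrictMono φ ∧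
        Tendsto (fun k => blowupMeasure hG hθ (ε (φ k)) (u (φ k))) atTop (𝓝 P)) ∧
      ∀ (φ : ℕ → ℕ) (P : ProbabilityMeasure (G × X)), StrictMono φ →
        Tendsto (fun k => blowupMeasure hG hθ (ε (φ k)) (u (φ k))) atTop (𝓝 P) →
        (P : Measure (G × X)).map Prod.fst = (normLebesgue hG : Measure G) ∧
        IsTLambdaInvariant θ (P : Measure (G × X)) ∧
        (∀ᵐ p ∂(P : Measure (G × X)), ∃ x : ℕ → G,
          Tendsto (fun k => (x k,
            θ ((ε (φ k))⁻¹ • (x k : EuclideanSpace ℝ (Fin d))) (u (φ k)))) atTop (𝓝 p)) ∧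
        ∫⁻ p, f p ∂(P : Measure (G × X)) ≤
          liminf (fun k => macroEnergy θ fε (ε (φ k)) (u (φ k))) atTop ∧
        ∃ g : G × X → ℝ≥0∞, Measurable g ∧
          (∀ᵐ p ∂(P : Measure (G × X)),
            Tendsto (fun R : ℝ => ⨍⁻ a in U R, f (p.1, θ a p.2) ∂volume) atTop (𝓝 (g p))) ∧
          ∫⁻ p, f p ∂(P : Measure (G × X)) = ∫⁻ p, g p ∂(P : Measure (G × X))) ∧
    -- Part B
    (∀ ℙ : ℕ → ProbabilityMeasure X,
      Tendsto (fun M : ℝ≥0 =>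
        limsup (fun n => (ℙ n : Measure X) {v | (M : ℝ≥0∞) ≤ macroEnergy θ fε (ε n) v}) atTop)
        atTop (𝓝 0) →
      IsTightMeasureSet
        (range fun n => (blowupLaw hG hθ (ε n) (ℙ n) : Measure (ProbSpace (G × X)))) ∧
      ∃ (φ : ℕ → ℕ) (Q : ProbabilityMeasure (ProbSpace (G × X))), StrictMono φ ∧
        Tendsto (fun k => blowupLaw hG hθ (ε (φ k)) (ℙ (φ k))) atTop (𝓝 Q)) := by
  refine ⟨fun u ⟨C, hu⟩ => ⟨exists_subseq_tendsto_blowupMeasure hG hθ hfε hcoer hεpos hε hu,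
    fun φ P hφ hP => ?_⟩, fun ℙ hℙ => ?_⟩
  · have hεpos' : ∀ k, 0 < ε (φ k) := fun k => hεpos _
    have hε' : Tendsto (fun k => ε (φ k)) atTop (𝓝 0) := hε.comp hφ.tendsto_atTop
    have hu' : ∀ k, macroEnergy θ fε (ε (φ k)) (u (φ k)) ≤ C := fun k => hu _
    have hlow := lintegral_le_liminf_macroEnergy hG hθ hfε hf hliminf hεpos' hε' hu' hP
    have hGne : Nonempty G := (nonempty_of_measure_ne_zero hG.volume_pos.ne').to_subtype
    refine ⟨map_fst_eq_normLebesgue hG hθ hP, isTLambdaInvariant_of_tendsto hG hθ hεpos' hε' hP,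
      ae_exists_tendsto_of_tendsto hP (fun k (x : G) =>
        (x, θ ((ε (φ k))⁻¹ • (x : EuclideanSpace ℝ (Fin d))) (u (φ k))))
        fun k => measure_eq_zero_iff_ae_notMem.1 (blowupMeasure_compl_range hG hθ _ _) |>.mono
          fun z hz => not_not.1 hz,
      hlow, ?_⟩
    -- The ergodic theorem needs a finite integral of `f`; the lower bound just proved supplies it,
    -- with bound `C`.
    refine exists_tendsto_setLAverage (isPreservingAction_of_invariant hθ
      (map_const_shift_eq hG hθ hεpos' hε' hP)) hU hf (ne_top_of_le_ne_top
      (ENNReal.coe_ne_top (r := C)) (hlow.trans ?_))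
    exact liminf_le_of_le (by isBoundedDefault) fun b hb => by
      obtain ⟨k, hk⟩ := hb.exists
      exact hk.trans (hu' k)
  · have htight := isTightMeasureSet_blowupLaw hG hθ hfε hcoer hεpos hε hℙ
    exact ⟨htight, exists_subseq_tendsto_of_isTightMeasureSet htight⟩
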